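/- Let $k$ be a non-archimedean local field of characteristic $0$ with valuation ring $R$ and normalized valuation $v$. Let $D$ be a central division algebra over $k$ of degree $m$, let $\Delta$ be the maximal $R$-order of $D$, and let $\boldsymbol{\pi}\in D^\times$ be a prime element of $\Delta$ such that $\boldsymbol{\pi}^m$ is a uniformizer of $R$; put $\mathfrak p=\boldsymbol{\pi}\Delta$. Let $n\ge 1$, $A=M_n(D)$, and write $\mathrm{nr}=\mathrm{nr}_{A/k}$ for the reduced norm. For $x\in \mathrm{GL}_n(D)$ define its type by $t(x)=v_D(\det x)\bmod n\in\mathbb Z/n\mathbb Z$, where $\det:\mathrm{GL}_n(D)\to D^\times/[D^\times,D^\times]$ is the Dieudonné determinant and $v_D$ is the normalized valuation of $D$, i.e. $v_D(a)=v(\mathrm{nr}_{D/k}(a))$. Let $\Gamma\subseteq M_n(D)$ be a tiled order, i.e. an $R$-order containing $g\,\mathrm{diag}(\Delta,\dots,\Delta)\,g^{-1}$ for some $g\in\mathrm{GL}_n(D)$, and fix such a $g$. Then there is a (necessarily unique) integer matrix $(\mu_{ij})_{1\le i,j\le n}$, the exponent matrix, such that $$g^{-1}\Gamma g=(\mathfrak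 p^{\mu_{ij}})=\{x\in M_n(D): x_{ij}\in\mathfrak p^{\mu_{ij}}\text{ for all }i,j\}.$$ Let $m_{ij\ell}=\mu_{ij}+\mu_{j\ell}-\mu_{i\ell}$ be the structural invariants, let $$H=\{\sigma\in S_n: m_{ij\ell}=m_{\sigma(i)\sigma(j)\sigma(\ell)}\text{ for all }i,j,\ell\},$$ and for $\sigma\in H$ let $\xi_\sigma\in\mathrm{GL}_n(D)$ be the monomial matrix $\bigl(\boldsymbol{\pi}^{\mu_{i1}-\mu_{\sigma(i)\sigma(1)}}\delta_{\sigma(i)j}\bigr)_{i,j}$. Then the set of types $\{t(\xi_\sigma):\sigma\in H\}$ is a subgroup of $\mathbb Z/n\mathbb Z$, hence equal to $d\mathbb Z/n\mathbb Z$ for a unique positive divisor $d$ of $n$, and the normalizer $\mathcal N(\Gamma)=\{\xi\in \mathrm{GL}_n(D):\xi\Gamma\xi^{-1}=\Gamma\}$ satisfies $$\mathrm{nr}(\mathcal N(\Gamma))=(k^\times)^d R^\times .$$ -/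

import Mathlib

open scoped ValuativeRel
open ValuativeRel

namespace TiledOrder

noncomputable section

/-! ### The local field and orders over its valuation ring -/

/-- The normalized (additive) valuation `v : kˣ → ℤ` of a non-archimedean local field, extended by
the junk value `v 0 = 0`. -/
def val (k : Type*) [Field k] [ValuativeRel k] [TopologicalSpace k]
    [IsNonarchimedeanLocalField k] (x : k) : ℤ :=
  -WithZero.log (IsNonarchimedeanLocalField.valueGroupWithZeroIsoInt k (valuation k x))

theorem val_one (k : Type*) [Field k] [ValuativeRel k] [TopologicalSpace k]
    [IsNonarchimedeanLocalField k] : val k 1 = 0 := by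
  simp [val]

theorem val_mul {k : Type*} [Field k] [ValuativeRel k] [TopologicalSpace k]
    [IsNonarchimedeanLocalField k] {x y : k} (hx : x ≠ 0) (hy : y ≠ 0) :
    val k (x * y) = val k x + val k y := by
  unfold val
  rw [map_mul, map_mul, WithZero.log_mul (by simpa using hx) (by simpa using hy)]
  ring

/-- A (full) `𝒪[k]`-order in a `k`-algebra `A`: an `𝒪[k]`-subalgebra that is finitely generated as
an `𝒪[k]`-module and spans `A` over `k`. -/
structure IsOrder (k : Type*) [Field k] [ValuativeRel k] {A : Type*} [Ring A] [Algebra k A]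
    (Γ : Subalgebra 𝒪[k] A) : Prop where
  fg : (Subalgebra.toSubmodule Γ).FG
  span_eq_top : Submodule.span k (Γ : Set A) = ⊤

/-! ### Central simple algebras -/

/-- The degree of a central simple `k`-algebra: the square root of its dimension. -/
def degree (k A : Type*) [Field k] [Ring A] [Algebra k A] : ℕ :=
  Nat.sqrt (Module.finrank k A)

/-- `c` is the reduced norm of `a`: it is the determinant of the image of `a` under every splitting
`A → M_N(k̄)`, `N = deg A`. (For a central simple algebra such maps exist, are all conjugate, and
the determinant lies in `k`, so that there is exactly one such `c`.) -/
def IsReducedNorm (k A : Type*) [Field k] [Ring A] [Algebra k A] (a : A) (c : k) : Prop :=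
  ∀ φ : A →ₐ[k] Matrix (Fin (degree k A)) (Fin (degree k A)) (AlgebraicClosure k),
    (φ a).det = algebraMap k (AlgebraicClosure k) c

/-- The reduced norm `nr_{A/k} : A → k` of a central simple algebra. -/
def nr (k A : Type*) [Field k] [Ring A] [Algebra k A] (a : A) : k :=
  Classical.epsilon (IsReducedNorm k A a)

/-! ### The valuation of a division algebra, Dieudonné determinant, types -/

section Division

variable (k : Type*) [Field k] [ValuativeRel k] [TopologicalSpace k]
  [IsNonarchimedeanLocalField k]
variable (D : Type*) [DivisionRing D] [Algebra k D]

/-- The homomorphism `a ↦ v(N_{D/k}(a))` on `Dˣ`, where `N_{D/k}` is the (non-reduced) norm. -/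
def valNorm : Dˣ →* Multiplicative ℤ where
  toFun a := Multiplicative.ofAdd (val k (Algebra.norm k (a : D)))
  map_one' := by simp [val_one]
  map_mul' a b := by
    have h : ∀ c : Dˣ, Algebra.norm k (c : D) ≠ 0 := fun c =>
      ((c.isUnit).map (Algebra.norm k)).ne_zero
    rw [Units.val_mul, map_mul, val_mul (h a) (h b), ofAdd_add]

/-- The normalized valuation of `D`, as a function on `Dˣ/[Dˣ, Dˣ]`: it is
`v_D(a) = v(N_{D/k}(a)) / m = v(nr_{D/k}(a))` with `m = deg D`; the division is exact since
`N_{D/k} = nr_{D/k} ^ m`. -/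
def valD (a : Abelianization Dˣ) : ℤ :=
  (Abelianization.lift (valNorm k D) a).toAdd / (degree k D : ℤ)

end Division

section Matrices

variable {D : Type*} [DivisionRing D] {n : ℕ}

/-- The subgroup `E_n(D)` of `GL_n(D)` generated by the elementary matrices `1 + c e_{ij}`,
`i ≠ j`. -/
def elementary (D : Type*) [DivisionRing D] (n : ℕ) : Subgroup (Matrix (Fin n) (Fin n) D)ˣ :=
  Subgroup.closure {g | ∃ (i j : Fin n) (c : D), i ≠ j ∧
    (g : Matrix (Fin n) (Fin n) D) = 1 + Matrix.single i j c}

/-- `c` is a Dieudonné determinant of `g`: `g = e · diag(y, 1, …, 1)` with `e ∈ E_n(D)` and `c` is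
the class of `y`. (By Dieudonné's theorem there is exactly one such `c`.) -/
def IsDieudonneDet [NeZero n] (g : (Matrix (Fin n) (Fin n) D)ˣ) (c : Abelianization Dˣ) : Prop :=
  ∃ e ∈ elementary D n, ∃ y : Dˣ, c = Abelianization.of y ∧
    (g : Matrix (Fin n) (Fin n) D) =
      (e : Matrix (Fin n) (Fin n) D) * Matrix.diagonal (fun i => if i = 0 then (y : D) else 1)

/-- The Dieudonné determinant `det : GL_n(D) → Dˣ/[Dˣ, Dˣ]`. -/
def dieudonneDet [NeZero n] (g : (Matrix (Fin n) (Fin n) D)ˣ) : Abelianization Dˣ :=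
  Classical.epsilon (IsDieudonneDet g)

/-- The type `t(g) = v_D(det g) mod n` of `g ∈ GL_n(D)`. -/
def type (k : Type*) [Field k] [ValuativeRel k] [TopologicalSpace k]
    [IsNonarchimedeanLocalField k] [Algebra k D] [NeZero n]
    (g : (Matrix (Fin n) (Fin n) D)ˣ) : ZMod n :=
  (valD k D (dieudonneDet g) : ZMod n)

/-- The monomial matrix `(ϖ ^ (α i) δ_{σ(i) j})`. -/
def monomial (ϖ : Dˣ) (α : Fin n → ℤ) (σ : Equiv.Perm (Fin n)) :
    (Matrix (Fin n) (Fin n) D)ˣ where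
  val := Matrix.of fun i j => if σ i = j then ((ϖ ^ α i : Dˣ) : D) else 0
  inv := Matrix.of fun i j => if σ j = i then ((ϖ ^ (-α j) : Dˣ) : D) else 0
  val_inv := by
    ext i j
    rw [Matrix.mul_apply, Finset.sum_eq_single (σ i)]
    · by_cases h : i = j
      · subst h; simp [mul_inv_cancel₀ (zpow_ne_zero _ ϖ.ne_zero)]
      · have h' : σ j ≠ σ i := fun e => h (σ.injective e).symm
        simp [h, h']
    · intro b _ hb
      simp [hb.symm]
    · simp
  inv_val := by
    ext i j
    rw [Matrix.mul_apply, Finset.sum_eq_single (σ.symm i)]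
    · by_cases h : i = j
      · subst h; simp [inv_mul_cancel₀ (zpow_ne_zero _ ϖ.ne_zero)]
      · simp [h]
    · intro b _ hb
      have h' : σ b ≠ i := fun e => hb (by simp [← e])
      simp [h']
    · simp

/-- The power `𝔭 ^ c = ϖ ^ c Δ` (`c ∈ ℤ`) of the ideal `𝔭 = ϖ Δ`. -/
def primePow (Δ : Set D) (ϖ : Dˣ) (c : ℤ) : Set D :=
  {x | ∃ δ ∈ Δ, x = ((ϖ ^ c : Dˣ) : D) * δ}

end Matrices

/-! ### Structural invariants -/

section Invariants

variable {n : ℕ} (μ : Matrix (Fin n) (Fin n) ℤ)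

/-- The structural invariants `m_{ijl} = μ_{ij} + μ_{jl} - μ_{il}`. -/
def structInv (i j l : Fin n) : ℤ := μ i j + μ j l - μ i l

/-- The symmetry group `H ≤ S_n` of the structural invariants. -/
def symmetryGroup : Subgroup (Equiv.Perm (Fin n)) where
  carrier := {σ | ∀ i j l, structInv μ i j l = structInv μ (σ i) (σ j) (σ l)}
  one_mem' := by intro i j l; rfl
  mul_mem' := by
    intro σ τ hσ hτ i j l
    rw [hτ i j l, hσ (τ i) (τ j) (τ l)]
    rfl
  inv_mem' := by
    intro σ hσ i j l
    rw [hσ (σ⁻¹ i) (σ⁻¹ j) (σ⁻¹ l)]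
    simp

/-- The monomial matrix `ξ_σ = (ϖ ^ (μ_{i1} - μ_{σ(i)σ(1)}) δ_{σ(i)j})`; the first index is
`0 : Fin n`. -/
def xi {D : Type*} [DivisionRing D] [NeZero n] (ϖ : Dˣ) (σ : Equiv.Perm (Fin n)) :
    (Matrix (Fin n) (Fin n) D)ˣ :=
  monomial ϖ (fun i => μ i 0 - μ (σ i) (σ 0)) σ

/-- The set of types `{t(ξ_σ) : σ ∈ H} ⊆ ℤ/nℤ`. -/
def typeSet (k : Type*) [Field k] [ValuativeRel k] [TopologicalSpace k]
    [IsNonarchimedeanLocalField k] {D : Type*} [DivisionRing D] [Algebra k D] [NeZero n]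
    (ϖ : Dˣ) : Set (ZMod n) :=
  {t | ∃ σ ∈ symmetryGroup μ, t = type k (xi μ ϖ σ)}

end Invariants

/-- The normalizer `𝒩(Γ) = {ξ ∈ Aˣ : ξ Γ ξ⁻¹ = Γ}`. -/
def normalizer {A : Type*} [Ring A] (Γ : Set A) : Set Aˣ :=
  {ξ | (fun x : A => (ξ : A) * x * ((ξ⁻¹ : Aˣ) : A)) '' Γ = Γ}

/-- The subgroup `(kˣ)^d Rˣ` of `kˣ`, `R = 𝒪[k]`, as a subset of `k`. -/
def powUnits (k : Type*) [Field k] [ValuativeRel k] (d : ℕ) : Set k :=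
  {x | ∃ (a : kˣ) (u : 𝒪[k]ˣ), x = (a : k) ^ d * ((u : 𝒪[k]) : k)}

end

end TiledOrder

/-!
After conjugation by `g` the order `Γ` becomes `T = (𝔭 ^ μ_{ij})`: a bounded ring containing the
diagonal idempotents is the direct sum of its matrix entries, and each entry is a fractional ideal
of `Δ` (`exists_exponentMatrix`). It remains to find the reduced norms of the normalizer of `T`.

*Valuations.* The elements of the normalizer of `T` are the products of a normalizing monomial
matrix and a unit of `T` (`exists_monomial_mul_of_normalizes`). Conceptually, an automorphism of
`T` permutes the isomorphism classes of indecomposable projectives; in the proof, the permutation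
comes from Hall's marriage theorem, and the marriage condition is extracted from an ultrametric
estimate on `ξ⁻¹ ξ = 1`. A unit of `T` is integral together with its inverse, so that its reduced
norm is a unit. A monomial matrix `(ϖ ^ (c i) δ_{σ(i) j})` normalizes `T` exactly when
`μ_{ij} = c_i - c_j + μ_{σ(i)σ(j)}`; such `c` exist exactly for `σ ∈ H`, they are those of `ξ_σ` up
to an additive constant `s`, and the reduced norm then has valuation `∑ c_i`, that is `t(ξ_σ)` up to
a multiple `n s` of `n`. So the valuations of the reduced norms of the normalizer form the preimage
in `ℤ` of the set of types (`intCast_mem_typeSet_iff`), which is therefore a subgroup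
`dℤ/nℤ`.

*Units.* The image of the normalizer contains `Rˣ`, because `nr : Δˣ → Rˣ` is surjective
(`exists_nr_eq_unit`) and `diag(θ, 1, …, 1)` with `θ ∈ Δˣ` normalizes `T`. For surjectivity, the
element `ϖ` with `ϖ ^ m = π` forces the residue field `F` of `D` to have degree at least `m` over
that of `k`. If `z ∈ Δ` lifts a generator `ζ` of the cyclic group `Fˣ`, its minimal polynomial has
degree `m` and reduces to that of `ζ`. The constant coefficient can be changed to any
element with the same residue: by Hensel's lemma the new polynomial has a root in `R[z]`, and the
reduced norm of that root is, up to sign, the new constant coefficient. Thus every unit of `R`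
with residue `N(ζ)` is a reduced norm, and such units generate `Rˣ`, as the norm of finite fields
is surjective.

*Reduced norms and valuations of `D`.* The reduced norm is controlled by
`N_{A/k} = nr ^ deg A` (`nr_pow_degree`), which also shows, by Galois descent, that reduced
characteristic polynomials have coefficients in `k`. The function `v ∘ nr` is a valuation of `D`
(`valDiv`), whose unit ball consists of the integral elements: the elements with norm in `R` lie in
a lattice, by compactness.
-/

open scoped TensorProduct WithZero

namespace TiledOrder

noncomputable section

/-! ### Central simple algebras and the reduced norm -/

section CSA

variable (k A : Type*) [Field k] [Ring A] [Algebra k A]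

/-- The `k`-algebra of endomorphisms of `A` generated by the left and right multiplications. -/
def mulAlgebra : Subalgebra k (Module.End k A) :=
  Algebra.adjoin k (Set.range (LinearMap.mulLeft k) ∪ Set.range (LinearMap.mulRight k))

variable {k A}

lemma mulLeft_mem_mulAlgebra (a : A) : LinearMap.mulLeft k a ∈ mulAlgebra k A :=
  Algebra.subset_adjoin (Or.inl ⟨a, rfl⟩)

lemma mulRight_mem_mulAlgebra (a : A) : LinearMap.mulRight k a ∈ mulAlgebra k A :=
  Algebra.subset_adjoin (Or.inr ⟨a, rfl⟩)

/-- The submodules of `A` over its multiplication algebra are the two-sided ideals. -/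
lemma isSimpleModule_mulAlgebra [IsSimpleRing A] : IsSimpleModule (mulAlgebra k A) A := by
  refine (isSimpleModule_iff _ _).2 { eq_bot_or_eq_top := fun S => ?_ }
  let I : TwoSidedIdeal A := TwoSidedIdeal.mk' S S.zero_mem S.add_mem
    (fun {x} hx => by
      have h : (-1 : A) * x ∈ S := S.smul_mem ⟨_, mulLeft_mem_mulAlgebra (-1)⟩ hx
      simpa using h)
    (fun {x y} hy => S.smul_mem ⟨_, mulLeft_mem_mulAlgebra x⟩ hy)
    (fun {x y} hx => S.smul_mem ⟨_, mulRight_mem_mulAlgebra y⟩ hx)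
  have hI : ∀ x, x ∈ I ↔ x ∈ S := fun x => by
    apply TwoSidedIdeal.mem_mk'
  rcases eq_bot_or_eq_top I with h | h
  · left
    ext x
    rw [← hI, h]; simp [TwoSidedIdeal.mem_bot]
  · right
    ext x
    rw [← hI, h]; simp

/-- Every `k`-linear endomorphism of a central simple algebra `A` is a sum of maps `x ↦ a x b`:
the endomorphisms of `A` commuting with these maps are the scalars, and Jacobson density applies. -/
lemma mulAlgebra_eq_top [IsSimpleRing A] [Algebra.IsCentral k A] [FiniteDimensional k A] :
    mulAlgebra k A = ⊤ := by
  have := isSimpleModule_mulAlgebra (k := k) (A := A)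
  refine eq_top_iff.2 fun f _ => ?_
  have hcent : ∀ g : Module.End (mulAlgebra k A) A, ∃ c : k, ∀ x, g x = c • x := by
    intro g
    have hl : ∀ a x, g (a * x) = a * g x := fun a x =>
      g.map_smul ⟨_, mulLeft_mem_mulAlgebra a⟩ x
    have hr : ∀ a x, g (x * a) = g x * a := fun a x =>
      g.map_smul ⟨_, mulRight_mem_mulAlgebra a⟩ x
    have hc : g 1 ∈ Subalgebra.center k A := by
      rw [Subalgebra.mem_center_iff]
      intro a
      rw [← hl, ← hr, one_mul, mul_one]
    obtain ⟨c, hc⟩ := (Algebra.IsCentral.mem_center_iff k).1 hc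
    refine ⟨c, fun x => ?_⟩
    have := hr x 1
    rwa [one_mul, hc, ← Algebra.smul_def] at this
  let F : Module.End (Module.End (mulAlgebra k A) A) A :=
    { toFun := f
      map_add' := f.map_add
      map_smul' := fun g x => by
        obtain ⟨c, hc⟩ := hcent g
        simp [Module.End.smul_def, hc] }
  classical
  let b := Module.finBasis k A
  obtain ⟨r, hr⟩ := jacobson_density (R := mulAlgebra k A) (M := A) F (Finset.univ.image b)
  have : f = r.1 := b.ext fun i => hr (b i) (Finset.mem_image_of_mem _ (Finset.mem_univ i))
  rw [this]
  exact r.2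

/-- Base change preserves simplicity: an ideal of `K ⊗ A` is stable under all `1 ⊗ f` with `f` a
`k`-linear endomorphism of `A`, since `f` is a sum of two-sided multiplications. -/
lemma isSimpleRing_tensorProduct (K : Type*) [Field K] [Algebra k K]
    [IsSimpleRing A] [Algebra.IsCentral k A] [FiniteDimensional k A] :
    IsSimpleRing (K ⊗[k] A) := by
  have : Nontrivial (K ⊗[k] A) := inferInstance
  refine .of_eq_bot_or_eq_top fun I => or_iff_not_imp_left.2 fun hI => ?_
  have hL : ∀ (a : A) (x : K ⊗[k] A), (LinearMap.mulLeft k a).lTensor K x = (1 ⊗ₜ a) * x := by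
    intro a x
    induction x using TensorProduct.induction_on with
    | zero => simp
    | tmul c y => simp
    | add y z hy hz => rw [map_add, mul_add, hy, hz]
  have hR : ∀ (a : A) (x : K ⊗[k] A), (LinearMap.mulRight k a).lTensor K x = x * (1 ⊗ₜ a) := by
    intro a x
    induction x using TensorProduct.induction_on with
    | zero => simp
    | tmul c y => simp
    | add y z hy hz => rw [map_add, add_mul, hy, hz]
  have hf : ∀ f : Module.End k A, ∀ x ∈ I, f.lTensor K x ∈ I := by
    intro f
    have hf : f ∈ mulAlgebra k A := by rw [mulAlgebra_eq_top]; trivial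
    refine Algebra.adjoin_induction (p := fun f _ => ∀ x ∈ I, f.lTensor K x ∈ I) ?_ ?_ ?_ ?_ hf
    · rintro _ (⟨a, rfl⟩ | ⟨a, rfl⟩) x hx
      · rw [hL]
        exact I.mul_mem_left _ _ hx
      · rw [hR]
        exact I.mul_mem_right _ _ hx
    · intro c x hx
      have : (algebraMap k (Module.End k A) c).lTensor K x = algebraMap k (K ⊗[k] A) c * x := by
        rw [← Algebra.smul_def, Module.algebraMap_end_eq_smul_id, LinearMap.lTensor_smul]
        simp
      rw [this]
      exact I.mul_mem_left _ _ hx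
    · intro f g _ _ hf hg x hx
      rw [LinearMap.lTensor_add]
      exact I.add_mem (hf x hx) (hg x hx)
    · intro f g _ _ hf hg x hx
      rw [LinearMap.lTensor_mul]
      exact hf _ (hg x hx)
  obtain ⟨x, hx, hx0⟩ : ∃ x ∈ I, x ≠ 0 := by
    by_contra! h
    exact hI (le_bot_iff.1 fun x hx => (TwoSidedIdeal.mem_bot _).2 (h x hx))
  let b := Module.finBasis k A
  let B := Algebra.TensorProduct.basis K b
  obtain ⟨j, hj⟩ : ∃ j, B.repr x j ≠ 0 := by
    by_contra! h
    exact hx0 (B.repr.map_eq_zero_iff.1 (Finsupp.ext h))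
  -- applying the `j`-th coordinate functional produces the unit `c ⊗ 1` of the ideal
  have key : ((b.coord j).smulRight (1 : A)).lTensor K x = B.repr x j ⊗ₜ 1 := by
    clear hx hx0 hj
    induction x using TensorProduct.induction_on with
    | zero => simp
    | tmul c y =>
      rw [LinearMap.lTensor_tmul, LinearMap.smulRight_apply, Module.Basis.coord_apply,
        TensorProduct.tmul_smul, TensorProduct.smul_tmul', Algebra.TensorProduct.basis_repr_tmul]
      simp [Algebra.smul_def, mul_comm]
    | add y z hy hz =>
      simp only [map_add, hy, hz, Finsupp.add_apply, TensorProduct.add_tmul]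
  have h1 := I.mul_mem_left ((B.repr x j)⁻¹ ⊗ₜ 1) _ (key ▸ hf _ x hx)
  rw [Algebra.TensorProduct.tmul_mul_tmul, inv_mul_cancel₀ hj, mul_one] at h1
  exact (TwoSidedIdeal.one_mem_iff I).1 h1

lemma norm_matrix {K : Type*} [Field K] {N : ℕ} (M : Matrix (Fin N) (Fin N) K) :
    Algebra.norm K M = M.det ^ N := by
  let e : Matrix (Fin N) (Fin N) K ≃ₗ[K] (Fin N → Fin N → K) :=
    (Matrix.transposeLinearEquiv (Fin N) (Fin N) K K).trans (Matrix.ofLinearEquiv K).symm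
  have h : (e.toLinearMap ∘ₗ (LinearMap.mul K _ M) ∘ₗ e.symm.toLinearMap) =
      LinearMap.pi fun j => (Matrix.toLin' M) ∘ₗ LinearMap.proj j := by
    refine LinearMap.ext fun x => funext fun i => funext fun j => ?_
    simp [e, Matrix.mul_apply, Matrix.mulVec, dotProduct, mul_comm]
  rw [Algebra.norm_apply, ← LinearMap.det_conj _ e]
  erw [h]
  rw [LinearMap.det_pi]
  simp

/-- For a splitting `φ : A → M_N(K)`, the power `det (φ a) ^ N` is the norm `N_{A/k}(a)`, so that it
does not depend on `φ` and lies in `k`. -/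
lemma det_splitting_pow [IsSimpleRing A] [Algebra.IsCentral k A] [FiniteDimensional k A]
    {K : Type*} [Field K] [Algebra k K] {N : ℕ} (hN : Module.finrank k A = N ^ 2)
    (φ : A →ₐ[k] Matrix (Fin N) (Fin N) K) (a : A) :
    (φ a).det ^ N = algebraMap k K (Algebra.norm k a) := by
  have := isSimpleRing_tensorProduct (k := k) (A := A) K
  let Φ : K ⊗[k] A →ₐ[K] Matrix (Fin N) (Fin N) K :=
    Algebra.TensorProduct.lift (Algebra.ofId K _) φ (fun c x => Algebra.commutes c (φ x))
  have hne : N ≠ 0 := by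
    rintro rfl
    have : Module.finrank k A ≠ 0 := Module.finrank_pos.ne'
    simp_all
  have : NeZero N := ⟨hne⟩
  have hinj : Function.Injective Φ := Φ.toRingHom.injective
  let e : (K ⊗[k] A) ≃ₗ[K] Matrix (Fin N) (Fin N) K :=
      LinearEquiv.ofInjectiveOfFinrankEq Φ.toLinearMap hinj (by
    simp [Module.finrank_matrix, hN, sq])
  have h1 : algebraMap k K (Algebra.norm k a) = Algebra.norm K ((1 : K) ⊗ₜ[k] a) := by
    rw [Algebra.norm_apply, Algebra.norm_apply]
    rw [← LinearMap.det_baseChange]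
    rw [← Algebra.baseChange_lmul]
  have h2 : Algebra.norm K ((1 : K) ⊗ₜ[k] a) = Algebra.norm K (φ a) := by
    rw [Algebra.norm_apply, Algebra.norm_apply, ← LinearMap.det_conj _ e]
    congr 1
    ext1 x
    obtain ⟨x, rfl⟩ := e.surjective x
    have he : ∀ x, e x = Φ x := fun x => rfl
    change e (1 ⊗ₜ a * e.symm (e x)) = φ a * e x
    rw [e.symm_apply_apply, he, map_mul, he]
    rw [show Φ (1 ⊗ₜ a) = φ a from (Algebra.TensorProduct.lift_tmul _ _ _ _ _).trans (by simp)]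
  rw [h1, h2, norm_matrix]

/-- A central simple algebra is split by every algebraically closed extension, and its dimension is
the square of its degree. -/
lemma exists_splitting (K : Type*) [Field K] [IsAlgClosed K] [Algebra k K]
   [IsSimpleRing A] [Algebra.IsCentral k A] [FiniteDimensional k A] :
    Module.finrank k A = degree k A ^ 2 ∧
        Nonempty (A →ₐ[k] Matrix (Fin (degree k A)) (Fin (degree k A)) K) := by
  have := isSimpleRing_tensorProduct (k := k) (A := A) K
  obtain ⟨N, _, ⟨e⟩⟩ := IsSimpleRing.exists_algEquiv_matrix_of_isAlgClosed K (K ⊗[k] A)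
  have hN : Module.finrank k A = N ^ 2 := by
    have := e.toLinearEquiv.finrank_eq
    simpa [Module.finrank_matrix, sq] using this
  have hd : degree k A = N := by rw [degree, hN, Nat.sqrt_eq']
  rw [hd]
  exact ⟨hN, ⟨(e.toAlgHom.restrictScalars k).comp Algebra.TensorProduct.includeRight⟩⟩

variable (k) in
lemma degree_pos [IsSimpleRing A] [Algebra.IsCentral k A] [FiniteDimensional k A] :
    0 < degree k A := by
  have h := (exists_splitting (k := k) (A := A) (AlgebraicClosure k)).1
  have : Module.finrank k A ≠ 0 := Module.finrank_pos.ne'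
  rw [h] at this
  exact Nat.pos_of_ne_zero fun h0 => this (by rw [h0]; rfl)

lemma aeval_eq_zero_of_charpoly_eq [IsSimpleRing A] [Algebra.IsCentral k A]
    [FiniteDimensional k A] {a : A} {p : Polynomial k}
    (h : ∀ φ : A →ₐ[k] Matrix (Fin (degree k A)) (Fin (degree k A)) (AlgebraicClosure k),
      (φ a).charpoly = p.map (algebraMap k (AlgebraicClosure k))) : Polynomial.aeval a p = 0 := by
  obtain ⟨-, ⟨φ⟩⟩ := exists_splitting (k := k) (A := A) (AlgebraicClosure k)
  have : NeZero (degree k A) := ⟨(degree_pos k).ne'⟩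
  apply φ.toRingHom.injective
  rw [map_zero]
  change φ _ = 0
  rw [← Polynomial.aeval_algHom_apply, ← Polynomial.aeval_map_algebraMap (AlgebraicClosure k),
    ← h φ, Matrix.aeval_self_charpoly]

lemma eq_of_monic_pow_eq {K : Type*} [Field K] {p q : Polynomial K} (hp : p.Monic) (hq : q.Monic)
    {N : ℕ} (hN : N ≠ 0) (h : p ^ N = q ^ N) : p = q := by
  have h1 : p ∣ q := (IsIntegrallyClosed.pow_dvd_pow_iff hN).1 h.dvd
  have h2 : q ∣ p := (IsIntegrallyClosed.pow_dvd_pow_iff hN).1 h.symm.dvd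
  exact Polynomial.eq_of_monic_of_associated hp hq (associated_of_dvd_dvd h1 h2)

section
variable [CharZero k] [IsSimpleRing A] [Algebra.IsCentral k A] [FiniteDimensional k A]

lemma charpoly_splitting_pow {K : Type*} [Field K] [Algebra k K] {N : ℕ}
    (hN : Module.finrank k A = N ^ 2) (φ : A →ₐ[k] Matrix (Fin N) (Fin N) K) (a : A) :
    (φ a).charpoly ^ N = ((LinearMap.mulLeft k a).charpoly).map (algebraMap k K) := by
  refine Polynomial.eq_of_infinite_eval_eq _ _
    (Set.infinite_of_injective_forall_mem (algebraMap k K).injective (f := algebraMap k K) fun c =>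
        ?_)
  have h := det_splitting_pow hN φ (algebraMap k A c - a)
  rw [map_sub, AlgHom.commutes] at h
  rw [Set.mem_ofPred_eq, Polynomial.eval_pow, Matrix.eval_charpoly, Polynomial.eval_map,
    Polynomial.eval₂_at_apply,
    LinearMap.eval_charpoly]
  rw [Algebra.norm_apply, map_sub, AlgHom.commutes] at h
  exact h

variable (k) in
/-- The reduced characteristic polynomial of `a`: it has coefficients in `k` because its power
of exponent `deg A` does, which makes it invariant under the Galois group, and it is independent of
the splitting. -/
lemma exists_reducedCharpoly (a : A) : ∃ p : Polynomial k, p.Monic ∧ p.natDegree = degree k A ∧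
    ∀ φ : A →ₐ[k] Matrix (Fin (degree k A)) (Fin (degree k A)) (AlgebraicClosure k),
      (φ a).charpoly = p.map (algebraMap k (AlgebraicClosure k)) := by
  obtain ⟨hN, ⟨φ⟩⟩ := exists_splitting (k := k) (A := A) (AlgebraicClosure k)
  have hpos := degree_pos k (A := A)
  have hcoeff : ∀ i, (φ a).charpoly.coeff i ∈ Set.range (algebraMap k (AlgebraicClosure k)) := by
    intro i
    rw [InfiniteGalois.mem_range_algebraMap_iff_fixed]
    intro σ
    have : (φ a).charpoly.map (σ : AlgebraicClosure k →+* AlgebraicClosure k) = (φ a).charpoly := by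
      refine eq_of_monic_pow_eq ((φ a).charpoly_monic.map _) (φ a).charpoly_monic hpos.ne' ?_
      rw [← Polynomial.map_pow, charpoly_splitting_pow hN, Polynomial.map_map]
      congr 1
      ext x
      simp
    conv_rhs => rw [← this]
    simp
  obtain ⟨p, hp, hdeg, hmon⟩ := Polynomial.lifts_and_degree_eq_and_monic
    ((Polynomial.lifts_iff_coeff_lifts _).2 hcoeff) (φ a).charpoly_monic
  refine ⟨p, hmon, ?_, fun ψ => ?_⟩
  · rw [Polynomial.natDegree_eq_of_degree_eq hdeg, Matrix.charpoly_natDegree_eq_dim,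
      Fintype.card_fin]
  · rw [hp]
    refine eq_of_monic_pow_eq (ψ a).charpoly_monic (φ a).charpoly_monic hpos.ne' ?_
    rw [charpoly_splitting_pow hN, charpoly_splitting_pow hN]

/-- The reduced norm is not a junk value: the element defining it exists. -/
lemma isReducedNorm_nr (a : A) : IsReducedNorm k A a (nr k A a) := by
  obtain ⟨p, hp, hdeg, h⟩ := exists_reducedCharpoly k a
  refine Classical.epsilon_spec (p := IsReducedNorm k A a) ⟨(-1) ^ degree k A * p.coeff 0, fun φ =>
    ?_⟩
  rw [Matrix.det_eq_sign_charpoly_coeff, h φ]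
  simp

lemma nr_eq_of_splitting (φ : A →ₐ[k] Matrix (Fin (degree k A)) (Fin (degree k A))
    (AlgebraicClosure k))
    {a : A} {c : k} (h : (φ a).det = algebraMap k (AlgebraicClosure k) c) : nr k A a = c :=
  (algebraMap k (AlgebraicClosure k)).injective ((isReducedNorm_nr a φ).symm.trans h)

lemma nr_one : nr k A 1 = 1 := by
  obtain ⟨-, ⟨φ⟩⟩ := exists_splitting (k := k) (A := A) (AlgebraicClosure k)
  exact nr_eq_of_splitting φ (by simp)

lemma nr_mul (a b : A) : nr k A (a * b) = nr k A a * nr k A b := by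
  obtain ⟨-, ⟨φ⟩⟩ := exists_splitting (k := k) (A := A) (AlgebraicClosure k)
  exact nr_eq_of_splitting φ (by simp [isReducedNorm_nr a φ, isReducedNorm_nr b φ])

lemma nr_algebraMap (c : k) : nr k A (algebraMap k A c) = c ^ degree k A := by
  obtain ⟨-, ⟨φ⟩⟩ := exists_splitting (k := k) (A := A) (AlgebraicClosure k)
  refine nr_eq_of_splitting φ ?_
  rw [AlgHom.commutes, Matrix.algebraMap_eq_diagonal]
  simp

variable (k A) in
/-- The reduced norm as a homomorphism of monoids. -/
def nrHom : A →* k where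
  toFun := nr k A
  map_one' := nr_one
  map_mul' := nr_mul

@[simp] lemma nrHom_apply (a : A) : nrHom k A a = nr k A a := rfl

lemma nr_pow_degree (a : A) : nr k A a ^ degree k A = Algebra.norm k a := by
  obtain ⟨hN, ⟨φ⟩⟩ := exists_splitting (k := k) (A := A) (AlgebraicClosure k)
  apply (algebraMap k (AlgebraicClosure k)).injective
  rw [map_pow, ← isReducedNorm_nr a φ, det_splitting_pow hN]

lemma nr_ne_zero_of_isUnit {a : A} (ha : IsUnit a) : nr k A a ≠ 0 :=
  (ha.map (nrHom k A)).ne_zero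

/-- If `a` is a root of an irreducible polynomial of degree `deg A`, then that polynomial is its
reduced characteristic polynomial, and the reduced norm is the constant coefficient up to sign. -/
lemma nr_eq_of_aeval_eq_zero {f : Polynomial k} (hf : f.Monic) (hirr : Irreducible f)
    (hdeg : f.natDegree = degree k A) {a : A} (ha : Polynomial.aeval a f = 0) :
    nr k A a = (-1) ^ degree k A * f.coeff 0 := by
  obtain ⟨p, hp, hpdeg, h⟩ := exists_reducedCharpoly k a
  obtain ⟨-, ⟨φ⟩⟩ := exists_splitting (k := k) (A := A) (AlgebraicClosure k)
  have hpa := aeval_eq_zero_of_charpoly_eq h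
  have hfm : f = minpoly k a := minpoly.eq_of_irreducible_of_monic hirr ha hf
  have hfp : p = f := Polynomial.eq_of_monic_of_dvd_of_natDegree_le hf hp
      (hfm ▸ minpoly.dvd k a hpa) (by omega)
  refine nr_eq_of_splitting φ ?_
  rw [Matrix.det_eq_sign_charpoly_coeff, h φ, hfp]
  simp

lemma natDegree_minpoly_le (a : A) : (minpoly k a).natDegree ≤ degree k A := by
  obtain ⟨p, hp, hpdeg, h⟩ := exists_reducedCharpoly k a
  have hpa := aeval_eq_zero_of_charpoly_eq h
  exact hpdeg ▸ Polynomial.natDegree_le_of_dvd (minpoly.dvd k a hpa) hp.ne_zero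

/-- The reduced norm of an integral element is integral, being the product of the eigenvalues of its
image under a splitting. -/
lemma isIntegral_nr {R : Type*} [CommRing R] [Algebra R k] [Algebra R A] [IsScalarTower R k A]
    {a : A} (ha : IsIntegral R a) : IsIntegral R (nr k A a) := by
  obtain ⟨-, ⟨φ⟩⟩ := exists_splitting (k := k) (A := A) (AlgebraicClosure k)
  rw [← isIntegral_algebraMap_iff (algebraMap k (AlgebraicClosure k)).injective (A := k),
    ← isReducedNorm_nr a φ,
    Matrix.det_eq_prod_roots_charpoly]
  refine IsIntegral.multiset_prod fun x hx => ?_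
  obtain ⟨f, hf, hfa⟩ := ha
  refine ⟨f, hf, ?_⟩
  have hs := Matrix.mem_spectrum_of_isRoot_charpoly (Polynomial.isRoot_of_mem_roots hx)
  have h0 := spectrum.subset_polynomial_aeval (φ a) (f.map (algebraMap R (AlgebraicClosure k)))
    (Set.mem_image_of_mem _ hs)
  have hz : Polynomial.aeval (φ a) (f.map (algebraMap R (AlgebraicClosure k))) = 0 := by
    have h1 : Polynomial.aeval a (f.map (algebraMap R k)) = 0 := by
      rw [Polynomial.aeval_map_algebraMap]; exact hfa
    rw [IsScalarTower.algebraMap_eq R k (AlgebraicClosure k), ← Polynomial.map_map,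
      Polynomial.aeval_map_algebraMap, Polynomial.aeval_algHom_apply, h1, map_zero]
  have : Nonempty (Fin (degree k A)) := ⟨⟨0, degree_pos k⟩⟩
  rw [hz, spectrum.zero_eq, Set.mem_singleton_iff, Polynomial.eval_map] at h0
  exact h0

end
end CSA

/-! ### Elementary matrices and the Dieudonné determinant of monomial matrices -/

section Dieudonne
variable {D : Type*} [DivisionRing D] {n : ℕ}

/-- The diagonal matrix with given invertible entries, as a homomorphism `(Dˣ) ^ n → GL_n(D)`. -/
def diagHom (D : Type*) [DivisionRing D] (n : ℕ) : (Fin n → Dˣ) →* (Matrix (Fin n) (Fin n) D)ˣ :=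
  (Units.map (Matrix.diagonalRingHom (Fin n) D).toMonoidHom).comp
    (MulEquiv.piUnits (M := fun _ : Fin n => D)).symm.toMonoidHom

lemma coe_diagHom (b : Fin n → Dˣ) :
    (diagHom D n b : Matrix (Fin n) (Fin n) D) = Matrix.diagonal fun i => (b i : D) := rfl

/-- The elementary matrix `1 + c e_{ij}`, `i ≠ j`. -/
def transvectionUnit {i j : Fin n} (hij : i ≠ j) (c : D) : (Matrix (Fin n) (Fin n) D)ˣ where
  val := 1 + Matrix.single i j c
  inv := 1 + Matrix.single i j (-c)
  val_inv := by
    simp [mul_add, add_mul, Matrix.single_mul_single_of_ne _ _ _ _ hij.symm, add_assoc,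
      ← Matrix.single_add]
  inv_val := by
    simp [mul_add, add_mul, Matrix.single_mul_single_of_ne _ _ _ _ hij.symm, add_assoc,
      ← Matrix.single_add]

lemma transvectionUnit_mem {i j : Fin n} (hij : i ≠ j) (c : D) :
    transvectionUnit hij c ∈ elementary D n :=
  Subgroup.subset_closure ⟨i, j, c, hij, rfl⟩

/-- The Weyl element `t_{ij}(y) t_{ji}(-y⁻¹) t_{ij}(y)` of `E_n(D)`, where
`t_{ij}(c) = 1 + c e_{ij}`. -/
def weyl {i j : Fin n} (hij : i ≠ j) (y : Dˣ) : (Matrix (Fin n) (Fin n) D)ˣ :=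
  transvectionUnit hij (y : D) * transvectionUnit hij.symm (-(y⁻¹ : Dˣ) : D) *
    transvectionUnit hij (y : D)

lemma weyl_mem {i j : Fin n} (hij : i ≠ j) (y : Dˣ) : weyl hij y ∈ elementary D n :=
  mul_mem (mul_mem (transvectionUnit_mem _ _) (transvectionUnit_mem _ _)) (transvectionUnit_mem _ _)

lemma single_neg_eq (i j : Fin n) (c : D) : Matrix.single i j (-c) = -Matrix.single i j c :=
  map_neg (Matrix.singleAddMonoidHom i j) c

lemma coe_weyl {i j : Fin n} (hij : i ≠ j) (y : Dˣ) :
    (weyl hij y : Matrix (Fin n) (Fin n) D) = 1 - Matrix.single i i 1 - Matrix.single j j 1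
      + Matrix.single i j (y : D) - Matrix.single j i ((y⁻¹ : Dˣ) : D) := by
  simp only [weyl, transvectionUnit, Units.val_mul, mul_add, add_mul, one_mul, mul_one]
  simp [Matrix.single_mul_single_of_ne _ _ _ _ hij.symm, single_neg_eq]
  abel

lemma coe_diagHom_mulSingle (i : Fin n) (y : Dˣ) :
    (diagHom D n (Pi.mulSingle i y) : Matrix (Fin n) (Fin n) D) =
      1 - Matrix.single i i 1 + Matrix.single i i (y : D) := by
  rw [coe_diagHom]
  ext a b
  by_cases hab : a = b
  · subst hab
    by_cases ha : a = i
    · subst ha; simp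
    · simp [ha, Ne.symm ha]
  · have : ¬ (i = a ∧ i = b) := fun h => hab (h.1.symm.trans h.2)
    simp [hab, this]

/-- An invertible entry can be moved along the diagonal by elementary matrices. -/
lemma weyl_mul_weyl {i j : Fin n} (hij : i ≠ j) (y : Dˣ) :
    weyl hij y * weyl hij (-1) * diagHom D n (Pi.mulSingle j y) = diagHom D n (Pi.mulSingle i y) :=
        by
  ext1
  simp only [Units.val_mul, coe_weyl, coe_diagHom_mulSingle, mul_add, add_mul, mul_sub, sub_mul,
    one_mul, mul_one]
  simp [Matrix.single_mul_single_of_ne _ _ _ _ hij.symm,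
    Matrix.single_mul_single_of_ne _ _ _ _ hij, single_neg_eq]
  abel

lemma diagHom_mul_transvectionUnit (b : Fin n → Dˣ) {i j : Fin n} (hij : i ≠ j) (c : D) :
    diagHom D n b * transvectionUnit hij c =
      transvectionUnit hij (b i * c * ((b j)⁻¹ : Dˣ)) * diagHom D n b := by
  ext a b'
  simp only [coe_diagHom, transvectionUnit, Units.val_mul, mul_add, add_mul,
    Matrix.add_apply, Matrix.diagonal_mul, Matrix.mul_diagonal, Matrix.single_apply]
  by_cases h : i = a ∧ j = b'
  · obtain ⟨rfl, rfl⟩ := h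
    simp [Matrix.one_apply_ne hij]
  · rcases eq_or_ne a b' with rfl | hab
    · simp [h]
    · simp [h, hab]

lemma transvectionUnit_mul_self {i j : Fin n} (hij : i ≠ j) (c : D) :
    transvectionUnit hij c * transvectionUnit hij c = transvectionUnit hij (c + c) := by
  ext1
  simp [transvectionUnit, mul_add, add_mul, Matrix.single_mul_single_of_ne _ _ _ _ hij.symm,
    add_assoc, Matrix.single_add]

lemma diagHom_conj_elementary (b : Fin n → Dˣ) {e : (Matrix (Fin n) (Fin n) D)ˣ}
    (he : e ∈ elementary D n) : diagHom D n b * e * (diagHom D n b)⁻¹ ∈ elementary D n := by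
  have : elementary D n ≤ (elementary D n).comap (MulAut.conj (diagHom D n b)).toMonoidHom := by
    refine (Subgroup.closure_le _).2 ?_
    rintro g ⟨i, j, c, hij, hg⟩
    refine Subgroup.subset_closure ⟨i, j, b i * c * ((b j)⁻¹ : Dˣ), hij, ?_⟩
    have hg : g = transvectionUnit hij c := Units.ext hg
    change ((diagHom D n b * g * (diagHom D n b)⁻¹ : (Matrix (Fin n) (Fin n) D)ˣ) :
        Matrix (Fin n) (Fin n) D) = _
    rw [hg, diagHom_mul_transvectionUnit, mul_inv_cancel_right]
    rfl
  exact this he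

lemma monomial_eq (ϖ : Dˣ) (α : Fin n → ℤ) (σ : Equiv.Perm (Fin n)) :
    monomial ϖ α σ = diagHom D n (fun i => ϖ ^ α i) * monomial ϖ 0 σ := by
  ext i j
  simp [monomial, coe_diagHom, Matrix.diagonal_mul]

/-- Permutation matrices multiply contravariantly, since `monomial ϖ 0 σ` has its entries at
`(i, σ i)`. -/
lemma monomial_zero_mul (ϖ : Dˣ) (σ τ : Equiv.Perm (Fin n)) :
    monomial ϖ 0 (τ * σ) = monomial ϖ 0 σ * monomial ϖ 0 τ := by
  ext i j
  rw [Units.val_mul, Matrix.mul_apply, Finset.sum_eq_single (σ i)]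
  · simp [monomial]
  · intro b _ hb
    simp [monomial, hb.symm]
  · simp

lemma monomial_zero_one (ϖ : Dˣ) : monomial ϖ (0 : Fin n → ℤ) 1 = 1 := by
  ext i j
  simp [monomial, Matrix.one_apply]

variable [NeZero n]

lemma isDieudonneDet_iff {g : (Matrix (Fin n) (Fin n) D)ˣ} {c : Abelianization Dˣ} :
    IsDieudonneDet g c ↔ ∃ e ∈ elementary D n, ∃ y : Dˣ, c = Abelianization.of y ∧
      g = e * diagHom D n (Pi.mulSingle 0 y) := by
  have (y : Dˣ) : (diagHom D n (Pi.mulSingle 0 y) : Matrix (Fin n) (Fin n) D) =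
      Matrix.diagonal (fun i => if i = 0 then (y : D) else 1) := by
    rw [coe_diagHom]
    congr 1
    ext i
    rw [Pi.mulSingle_apply]
    split_ifs <;> rfl
  simp_rw [IsDieudonneDet, Units.ext_iff, Units.val_mul, this]

lemma IsDieudonneDet.mul {g h : (Matrix (Fin n) (Fin n) D)ˣ} {c d : Abelianization Dˣ}
    (hg : IsDieudonneDet g c) (hh : IsDieudonneDet h d) : IsDieudonneDet (g * h) (c * d) := by
  rw [isDieudonneDet_iff] at *
  obtain ⟨e, he, y, rfl, rfl⟩ := hg
  obtain ⟨f, hf, z, rfl, rfl⟩ := hh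
  refine ⟨_, mul_mem he (diagHom_conj_elementary (Pi.mulSingle 0 y) hf), y * z,
    (map_mul _ _ _).symm, ?_⟩
  rw [Pi.mulSingle_mul, map_mul]
  group

lemma exists_isDieudonneDet_mulSingle (i : Fin n) (y : Dˣ) :
    ∃ c, IsDieudonneDet (diagHom D n (Pi.mulSingle i y)) c := by
  refine ⟨Abelianization.of y, isDieudonneDet_iff.2 ?_⟩
  by_cases hi : i = 0
  · subst hi
    exact ⟨1, one_mem _, y, rfl, (one_mul _).symm⟩
  · exact ⟨_, mul_mem (weyl_mem hi y) (weyl_mem hi (-1)), y, rfl, (weyl_mul_weyl hi y).symm⟩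

lemma exists_isDieudonneDet_one : ∃ c, IsDieudonneDet (1 : (Matrix (Fin n) (Fin n) D)ˣ) c := by
  simpa using exists_isDieudonneDet_mulSingle (D := D) (0 : Fin n) 1

lemma exists_isDieudonneDet_diagHom (b : Fin n → Dˣ) : ∃ c, IsDieudonneDet (diagHom D n b) c := by
  have key : ∀ s : Finset (Fin n), ∃ c, IsDieudonneDet (diagHom D n fun i =>
      if i ∈ s then b i else 1) c := by
    intro s
    induction s using Finset.induction_on with
    | empty => simpa [← Pi.one_def] using exists_isDieudonneDet_one
    | insert a s ha ih =>
      obtain ⟨c, hc⟩ := ih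
      obtain ⟨d, hd⟩ := exists_isDieudonneDet_mulSingle a (b a)
      refine ⟨c * d, ?_⟩
      convert hc.mul hd using 1
      rw [← map_mul]
      congr 1
      ext1 i
      by_cases h : i = a
      · subst h; simp [ha]
      · simp [h]
  simpa using key Finset.univ

/-- Monomial matrices have a Dieudonné determinant: a transposition matrix is a Weyl element times
a diagonal matrix with one entry `-1`. -/
lemma exists_isDieudonneDet_monomial (ϖ : Dˣ) (α : Fin n → ℤ) (σ : Equiv.Perm (Fin n)) :
    ∃ c, IsDieudonneDet (monomial ϖ α σ) c := by
  obtain ⟨c, hc⟩ := exists_isDieudonneDet_diagHom (fun i => ϖ ^ α i)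
  suffices h : ∃ c, IsDieudonneDet (monomial ϖ 0 σ) c by
    obtain ⟨d, hd⟩ := h
    exact ⟨_, monomial_eq ϖ α σ ▸ hc.mul hd⟩
  induction σ using Equiv.Perm.swap_induction_on with
  | one => rw [monomial_zero_one]; exact exists_isDieudonneDet_one
  | swap_mul σ i j hij ih =>
    obtain ⟨d, hd⟩ := ih
    obtain ⟨d', hd'⟩ := exists_isDieudonneDet_mulSingle i (-1 : Dˣ)
    have : IsDieudonneDet (weyl hij (1 : Dˣ)) 1 :=
      isDieudonneDet_iff.2 ⟨_, weyl_mem hij 1, 1, (map_one _).symm, by simp⟩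
    refine ⟨d * (1 * d'), ?_⟩
    rw [monomial_zero_mul]
    convert hd.mul (this.mul hd') using 2
    ext1
    rw [Units.val_mul, coe_weyl, coe_diagHom]
    ext a b
    rw [Matrix.mul_diagonal]
    simp only [monomial, Matrix.of_apply, Matrix.add_apply, Matrix.sub_apply, Matrix.single_apply,
      Matrix.one_apply]
    by_cases hai : a = i
    · subst hai
      by_cases hb : j = b
      · subst hb; simp [hij, hij.symm]
      · simp [hb, hij.symm]
    · by_cases haj : a = j
      · subst haj
        by_cases hb : b = i
        · subst hb; simp [hij, hij.symm]
        · simp [Ne.symm hb, hij]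
      · rw [Equiv.swap_apply_of_ne_of_ne hai haj]
        by_cases hb : b = i
        · subst hb; simp [hai, Ne.symm hai, Ne.symm haj]
        · simp [hb, Ne.symm hai, Ne.symm haj]

end Dieudonne

/-! ### The reduced norm of a matrix algebra -/

lemma degree_matrix (k D : Type*) [Field k] [DivisionRing D] [Algebra k D] [Algebra.IsCentral k D]
    [FiniteDimensional k D] (n : ℕ) :
    degree k (Matrix (Fin n) (Fin n) D) = n * degree k D := by
  have h := (exists_splitting (k := k) (A := D) (AlgebraicClosure k)).1
  rw [degree, Module.finrank_matrix, h, Fintype.card_fin, ← Nat.sqrt_eq' (n * degree k D)]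
  congr 1
  ring

section
variable {k D : Type*} [Field k] [CharZero k] [DivisionRing D] [Algebra k D] [Algebra.IsCentral k D]
  [FiniteDimensional k D] {n : ℕ} [NeZero n]

lemma nr_zero : nr k D 0 = 0 := by
  have h := nr_pow_degree (k := k) (0 : D)
  rw [Algebra.norm_zero] at h
  exact pow_eq_zero_iff (degree_pos k (A := D)).ne' |>.1 h

lemma nr_diagonal (a : Fin n → D) :
    nr k (Matrix (Fin n) (Fin n) D) (Matrix.diagonal a) = ∏ i, nr k D (a i) := by
  obtain ⟨hN, ⟨φ⟩⟩ := exists_splitting (k := k) (A := D) (AlgebraicClosure k)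
  let K := AlgebraicClosure k
  let m := degree k D
  let e : Fin n × Fin m ≃ Fin (degree k (Matrix (Fin n) (Fin n) D)) :=
    finProdFinEquiv.trans (finCongr (degree_matrix k D n).symm)
  let Ψ : Matrix (Fin n) (Fin n) D →ₐ[k] Matrix (Fin (degree k (Matrix (Fin n) (Fin n) D)))
      (Fin (degree k (Matrix (Fin n) (Fin n) D))) K :=
    ((Matrix.reindexAlgEquiv k K e).toAlgHom.comp
        (Matrix.compAlgEquiv (Fin n) (Fin m) K k).toAlgHom).comp
      φ.mapMatrix
  refine nr_eq_of_splitting Ψ ?_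
  have : Ψ (Matrix.diagonal a) = Matrix.reindex ((Equiv.prodComm _ _).trans e)
      ((Equiv.prodComm _ _).trans e)
      (Matrix.blockDiagonal fun i => φ (a i)) := by
    ext x y
    obtain ⟨⟨i, a'⟩, rfl⟩ := e.surjective x
    obtain ⟨⟨j, b'⟩, rfl⟩ := e.surjective y
    by_cases hij : i = j
    · subst hij; simp [Ψ, Matrix.blockDiagonal_apply]
    · simp [Ψ, Matrix.blockDiagonal_apply, hij]
  rw [this, Matrix.det_reindex_self, Matrix.det_blockDiagonal, map_prod]
  exact Finset.prod_congr rfl fun i _ => isReducedNorm_nr _ φ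

/-- Elementary matrices have reduced norm one, because each is a commutator: in characteristic
zero `1 + c e_{ij}` is conjugate to its own square. -/
lemma nr_transvectionUnit {i j : Fin n} (hij : i ≠ j) (c : D) :
    nr k (Matrix (Fin n) (Fin n) D) (transvectionUnit hij c) = 1 := by
  have h2 : (2 : D) ≠ 0 := by
    have : CharZero D := charZero_of_injective_algebraMap (algebraMap k D).injective
    exact two_ne_zero
  -- conjugating `t = 1 + c e_{ij}` by `diag(1, …, 2, …, 1)` gives `t²`
  have h := diagHom_mul_transvectionUnit (Pi.mulSingle i (Units.mk0 2 h2)) hij c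
  rw [Pi.mulSingle_eq_same, Pi.mulSingle_eq_of_ne hij.symm, inv_one, Units.val_one, mul_one,
    Units.val_mk0, two_mul, ← transvectionUnit_mul_self] at h
  have h' := congrArg (fun x : (Matrix (Fin n) (Fin n) D)ˣ => nr k (Matrix (Fin n) (Fin n) D) x) h
  simp only [Units.val_mul, nr_mul] at h'
  rw [mul_comm, mul_left_inj' (nr_ne_zero_of_isUnit (Units.isUnit _))] at h'
  exact (mul_left_cancel₀ (nr_ne_zero_of_isUnit (Units.isUnit _)) (by rw [mul_one]; exact h')).symm

lemma nr_elementary {e : (Matrix (Fin n) (Fin n) D)ˣ} (he : e ∈ elementary D n) :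
    nr k (Matrix (Fin n) (Fin n) D) e = 1 := by
  have : elementary D n ≤ (Units.map (nrHom k (Matrix (Fin n) (Fin n) D))).ker := by
    refine (Subgroup.closure_le _).2 ?_
    rintro g ⟨i, j, c, hij, hg⟩
    rw [SetLike.mem_coe, MonoidHom.mem_ker]
    have hg : g = transvectionUnit hij c := Units.ext hg
    ext
    simp [hg, nr_transvectionUnit hij]
  have h := this he
  rw [MonoidHom.mem_ker] at h
  exact congrArg Units.val h
end

/-! ### The valuation of the local field -/

section
variable (k : Type*) [Field k] [ValuativeRel k] [TopologicalSpace k] [IsNonarchimedeanLocalField k]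

/-- The normalized valuation of a local field in multiplicative notation: an element `x ≠ 0` is sent
to `exp (-val k x)`. -/
def valMul : Valuation k ℤᵐ⁰ :=
  (valuation k).map
    { toFun := IsNonarchimedeanLocalField.valueGroupWithZeroIsoInt k
      map_zero' := map_zero _
      map_one' := map_one _
      map_mul' := map_mul _ }
    (OrderHomClass.mono (IsNonarchimedeanLocalField.valueGroupWithZeroIsoInt k))

variable {k}

lemma valMul_eq_exp {x : k} (hx : x ≠ 0) : valMul k x = WithZero.exp (-val k x) := by
  rw [val, neg_neg, WithZero.exp_log]
  · rfl
  · simpa using hx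

lemma valMul_le_one_iff {x : k} : valMul k x ≤ 1 ↔ x ∈ 𝒪[k] := by
  rw [Valuation.mem_integer_iff]
  change IsNonarchimedeanLocalField.valueGroupWithZeroIsoInt k (valuation k x) ≤ 1 ↔ _
  rw [← map_one (IsNonarchimedeanLocalField.valueGroupWithZeroIsoInt k),
    OrderIsoClass.map_le_map_iff]

lemma mem_integer_iff_val_nonneg {x : k} (hx : x ≠ 0) : x ∈ 𝒪[k] ↔ 0 ≤ val k x := by
  rw [← valMul_le_one_iff, valMul_eq_exp hx, ← WithZero.exp_zero, WithZero.exp_le_exp]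
  omega

lemma val_pow {x : k} (hx : x ≠ 0) (j : ℕ) : val k (x ^ j) = j * val k x := by
  induction j with
  | zero => simp [val_one]
  | succ j ih => rw [pow_succ, val_mul (pow_ne_zero _ hx) hx, ih]; push_cast; ring

lemma val_inv {x : k} (hx : x ≠ 0) : val k x⁻¹ = - val k x := by
  have := val_mul hx (inv_ne_zero hx)
  rw [mul_inv_cancel₀ hx, val_one] at this
  omega

lemma val_zpow {x : k} (hx : x ≠ 0) (j : ℤ) : val k (x ^ j) = j * val k x := by
  cases j with
  | ofNat j => simpa using val_pow hx j
  | negSucc j =>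
    rw [zpow_negSucc, val_inv (pow_ne_zero _ hx), val_pow hx, Int.negSucc_eq]
    push_cast
    ring

lemma val_unit (u : 𝒪[k]ˣ) : val k ((u : 𝒪[k]) : k) = 0 := by
  have h : ∀ u : 𝒪[k]ˣ, ((u : 𝒪[k]) : k) ≠ 0 := fun u h => u.ne_zero (Subtype.ext h)
  have h1 := (mem_integer_iff_val_nonneg (h u)).1 (u : 𝒪[k]).2
  have h2 := (mem_integer_iff_val_nonneg (h u⁻¹)).1 ((u⁻¹ : 𝒪[k]ˣ) : 𝒪[k]).2
  have h3 := val_mul (h u) (h u⁻¹)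
  rw [← Subring.coe_mul, Units.mul_inv, Subring.coe_one, val_one] at h3
  omega

lemma exists_unit_of_val_eq_zero {x : k} (hx : x ≠ 0) (h : val k x = 0) : ∃ u :
    𝒪[k]ˣ, ((u : 𝒪[k]) : k) = x :=
  ⟨⟨⟨x, (mem_integer_iff_val_nonneg hx).2 h.ge⟩,
    ⟨x⁻¹, (mem_integer_iff_val_nonneg (inv_ne_zero hx)).2 (by rw [val_inv hx]; omega)⟩,
    Subtype.ext (mul_inv_cancel₀ hx), Subtype.ext (inv_mul_cancel₀ hx)⟩, rfl⟩

lemma val_irreducible {π : 𝒪[k]} (hπ : Irreducible π) : val k (π : k) = 1 := by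
  have hπ0 : (π : k) ≠ 0 := fun h => hπ.ne_zero (Subtype.ext h)
  obtain ⟨γ, hγ⟩ := (EquivLike.surjective (IsNonarchimedeanLocalField.valueGroupWithZeroIsoInt k))
    (WithZero.exp (-1))
  obtain ⟨y, rfl⟩ := valuation_surjective γ
  have hy0 : y ≠ 0 := by
    rintro rfl
    rw [map_zero, map_zero] at hγ
    exact WithZero.exp_ne_zero hγ.symm
  have hy : val k y = 1 := by rw [val, hγ]; simp
  have h0 := (mem_integer_iff_val_nonneg hπ0).1 π.2
  have hne : val k (π : k) ≠ 0 := by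
    intro h
    obtain ⟨u, hu⟩ := exists_unit_of_val_eq_zero hπ0 h
    exact hπ.not_isUnit ((Subtype.ext hu : (u : 𝒪[k]) = π) ▸ u.isUnit)
  obtain ⟨j, u, hu⟩ := IsDiscreteValuationRing.eq_unit_mul_pow_irreducible
    (x := (⟨y, (mem_integer_iff_val_nonneg hy0).2 (by omega)⟩ : 𝒪[k])) (fun h =>
        hy0 (congrArg Subtype.val h)) hπ
  have hu' : y = ((u : 𝒪[k]) : k) * (π : k) ^ j := congrArg Subtype.val hu
  rw [hu', val_mul (fun h => u.ne_zero (Subtype.ext h)) (pow_ne_zero _ hπ0), val_unit, val_pow hπ0,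
    zero_add] at hy
  have := Int.isUnit_iff.1 (IsUnit.of_mul_eq_one_right _ hy)
  omega

end

/-! ### The valuation of the division algebra -/

section
variable {k : Type*} [Field k] [ValuativeRel k] [TopologicalSpace k]
  [IsNonarchimedeanLocalField k]
variable {D : Type*} [DivisionRing D] [Algebra k D] [FiniteDimensional k D]

/-- The elements of norm in `R` of a finite-dimensional division algebra lie in a lattice: the norm
form does not vanish on the compact set of vectors with integral coordinates, one of them equal to
`1`, hence is bounded below there, and every nonzero vector is a multiple of one in that set. -/
lemma exists_lattice_of_norm_mem : ∃ Λ : Submodule 𝒪[k] D, Λ.FG ∧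
    ∀ z : D, Algebra.norm k z ∈ 𝒪[k] → z ∈ Λ := by
  classical
  let b := Module.finBasis k D
  set N := Module.finrank k D
  have hN : N ≠ 0 := Module.finrank_pos.ne'
  let f : (Fin N → k) → k := fun c => Algebra.norm k (b.equivFun.symm c)
  have hf : Continuous f := by
    let L : (Fin N → k) →ₗ[k] Matrix (Fin N) (Fin N) k :=
      (Algebra.leftMulMatrix b).toLinearMap ∘ₗ b.equivFun.symm.toLinearMap
    have hfL : f = fun c => (L c).det := funext fun c => Algebra.norm_eq_matrix_det b _
    rw [hfL]
    refine Continuous.matrix_det (continuous_matrix fun i j => ?_)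
    exact LinearMap.continuous_on_pi ((Matrix.entryLinearMap k k i j) ∘ₗ L)
  have : T2Space k := by
    let := IsTopologicalAddGroup.rightUniformSpace k
    have := isUniformAddGroup_of_addCommGroup (G := k)
    infer_instance
  let P : Fin N → Set (Fin N → k) := fun i => Set.univ.pi fun j =>
      if j = i then {1} else {x | valuation k x ≤ 1}
  have hP : IsCompact (⋃ i, P i) := by
    refine isCompact_iUnion fun i => isCompact_univ_pi fun j => ?_
    split_ifs
    · exact isCompact_singleton
    · exact IsNonarchimedeanLocalField.isCompact_closedBall k 1
  have h0 : (0 : k) ∉ f '' ⋃ i, P i := by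
    rintro ⟨c, hc, hc0⟩
    obtain ⟨i, hi⟩ := Set.mem_iUnion.1 hc
    have h1 : c i = 1 := by simpa using hi i trivial
    have h2 : b.equivFun.symm c = 0 := Algebra.norm_eq_zero_iff.1 hc0
    have : c = 0 := b.equivFun.symm.map_eq_zero_iff.1 h2
    simp [this] at h1
  obtain ⟨s, hs0, hs1, hs⟩ : ∃ s : k, s ≠ 0 ∧ valuation k s ≤ 1 ∧
    ∀ i, ∀ c ∈ P i, valuation k s ≤ valuation k (f c) := by
    have hnhds : (f '' ⋃ i, P i)ᶜ ∈ nhds (0 : k) := (hP.image hf).isClosed.isOpen_compl.mem_nhds h0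
    obtain ⟨r, hr, hrs⟩ := (IsValuativeTopology.hasBasis_nhds_zero' k).mem_iff.mp hnhds
    obtain ⟨s, rfl⟩ := valuation_surjective r
    have key : ∀ i, ∀ c ∈ P i, valuation k s ≤ valuation k (f c) := fun i c hc => by
      by_contra! h
      exact hrs h ⟨c, Set.mem_iUnion.2 ⟨i, hc⟩, rfl⟩
    rcases le_total (valuation k s) 1 with h | h
    · exact ⟨s, by simpa using hr, h, key⟩
    · exact ⟨1, one_ne_zero, by simp, fun i c hc => by simpa using h.trans (key i c hc)⟩
  refine ⟨Submodule.span 𝒪[k] (Set.range fun i => s⁻¹ • b i), Submodule.fg_span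
    (Set.finite_range _),
    fun z hz => ?_⟩
  by_cases hz0 : z = 0
  · rw [hz0]; exact zero_mem _
  have : Nonempty (Fin N) := ⟨⟨0, Nat.pos_of_ne_zero hN⟩⟩
  obtain ⟨i, hi⟩ := Finite.exists_max fun i => valuation k (b.equivFun z i)
  set c := b.equivFun z with hc
  have hci : c i ≠ 0 := by
    intro h
    refine hz0 (b.equivFun.map_eq_zero_iff.1 (funext fun j => ?_))
    have := hi j
    rw [h, map_zero, le_zero_iff, map_eq_zero] at this
    exact this
  have hcP : (fun j => (c i)⁻¹ * c j) ∈ P i := by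
    intro j _
    dsimp only
    split_ifs with h
    · subst h; simp [hci]
    · rw [Set.mem_ofPred_eq, map_mul, map_inv₀, inv_mul_le_iff₀
        (by simpa [zero_lt_iff] using hci), mul_one]
      exact hi j
  have hle : valuation k (c i) ^ N * valuation k s ≤ 1 := by
    have h1 : Algebra.norm k z = (c i) ^ N * f (fun j => (c i)⁻¹ * c j) := by
      have h2 : z = algebraMap k D (c i) * b.equivFun.symm (fun j => (c i)⁻¹ * c j) := by
        have h3 : (fun j => (c i)⁻¹ * c j) = (c i)⁻¹ • c := rfl
        rw [← Algebra.smul_def, h3, map_smul, smul_smul, mul_inv_cancel₀ hci, one_smul, hc,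
          b.equivFun.symm_apply_apply]
      conv_lhs => rw [h2, map_mul, Algebra.norm_algebraMap]
    rw [Valuation.mem_integer_iff, h1, map_mul, map_pow] at hz
    exact (mul_le_mul_right (hs i _ hcP) _).trans hz
  have hle2 : valuation k (c i) * valuation k s ≤ 1 := by
    rcases le_total (valuation k (c i)) 1 with h | h
    · exact mul_le_one' h hs1
    · exact (mul_le_mul_left (le_self_pow₀ h hN) _).trans hle
  rw [← b.sum_equivFun z]
  refine Submodule.sum_mem _ fun j _ => ?_
  have : c j * s ∈ 𝒪[k] := by
    rw [Valuation.mem_integer_iff, map_mul]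
    exact (mul_le_mul_left (hi j) _).trans hle2
  have h2 : c j • b j = (⟨c j * s, this⟩ : 𝒪[k]) • (s⁻¹ • b j) := by
    change _ = (c j * s) • (s⁻¹ • b j)
    rw [smul_smul, mul_assoc, mul_inv_cancel₀ hs0, mul_one]
  rw [h2]
  exact Submodule.smul_mem _ _ (Submodule.subset_span ⟨j, rfl⟩)

lemma isIntegral_of_norm_mem {z : D} (hz : Algebra.norm k z ∈ 𝒪[k]) : IsIntegral 𝒪[k] z := by
  obtain ⟨Λ, hΛ, h⟩ := exists_lattice_of_norm_mem (k := k) (D := D)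
  have : IsNoetherian 𝒪[k] Λ := isNoetherian_of_fg_of_noetherian _ hΛ
  have hle : Subalgebra.toSubmodule (Algebra.adjoin 𝒪[k] {z}) ≤ Λ := by
    rw [Algebra.adjoin_eq_span, Submodule.span_le]
    intro x hx
    obtain ⟨j, rfl⟩ := Submonoid.mem_closure_singleton.1 hx
    refine h _ ?_
    rw [map_pow]
    exact pow_mem hz j
  have hfin : Module.Finite 𝒪[k] (Algebra.adjoin 𝒪[k] {z}) :=
    Module.Finite.of_injective (Submodule.inclusion hle) (Submodule.inclusion_injective hle)
  have := Algebra.IsIntegral.of_finite 𝒪[k] (Algebra.adjoin 𝒪[k] {z})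
  exact (this.isIntegral ⟨z, Algebra.self_mem_adjoin_singleton _ z⟩).map
    (Algebra.adjoin 𝒪[k] {z}).val

variable [CharZero k] [Algebra.IsCentral k D]

lemma isIntegral_iff_nr_mem {z : D} : IsIntegral 𝒪[k] z ↔ nr k D z ∈ 𝒪[k] := by
  constructor
  · intro h
    have := IsIntegrallyClosed.isIntegral_iff.1 (isIntegral_nr (k := k) h)
    obtain ⟨y, hy⟩ := this
    exact hy ▸ y.2
  · intro h
    refine isIntegral_of_norm_mem (k := k) ?_
    rw [← nr_pow_degree]
    exact pow_mem h _

variable (k D) in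
/-- The normalized valuation of `D`, in multiplicative notation: the valuation of `k` composed with
the reduced norm. -/
def valDiv : Valuation D ℤᵐ⁰ where
  toFun x := valMul k (nr k D x)
  map_zero' := by rw [nr_zero, map_zero]
  map_one' := by rw [nr_one, map_one]
  map_mul' x y := by rw [nr_mul, map_mul]
  map_add_le_max' := by
    -- reduce to `1 + z` with `z` integral, where both elements lie in the commutative ring `R[z]`
    have key : ∀ z : D, valMul k (nr k D z) ≤ 1 → valMul k (nr k D (z + 1)) ≤ 1 := by
      intro z hz
      rw [valMul_le_one_iff, ← isIntegral_iff_nr_mem] at hz ⊢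
      let z' : Algebra.adjoin 𝒪[k] {z} := ⟨z, Algebra.self_mem_adjoin_singleton _ z⟩
      have hz' : IsIntegral 𝒪[k] z' :=
          (isIntegral_algHom_iff (Algebra.adjoin 𝒪[k] {z}).val Subtype.val_injective).1 hz
      have := Algebra.isMulCommutative_adjoin 𝒪[k] (s := {z}) (by simp)
      exact (hz'.add isIntegral_one).map (Algebra.adjoin 𝒪[k] {z}).val
    have key2 : ∀ x y : D, valMul k (nr k D x) ≤ valMul k (nr k D y) →
        valMul k (nr k D (x + y)) ≤ valMul k (nr k D y) := by
      intro x y hxy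
      by_cases hy : y = 0
      · subst hy
        simpa using hxy
      have hy' : valMul k (nr k D y) ≠ 0 := by
        simpa using nr_ne_zero_of_isUnit (k := k) (IsUnit.mk0 y hy)
      have h1 := key (x * y⁻¹) (by
        have : x = x * y⁻¹ * y := by rw [inv_mul_cancel_right₀ hy]
        rw [this, nr_mul, map_mul] at hxy
        exact (mul_le_iff_le_one_left (zero_lt_iff.2 hy')).1 hxy)
      have h2 : x + y = (x * y⁻¹ + 1) * y := by rw [add_mul, one_mul, inv_mul_cancel_right₀ hy]
      rw [h2, nr_mul, map_mul]
      exact mul_le_of_le_one_left' h1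
    intro x y
    rcases le_total (valMul k (nr k D x)) (valMul k (nr k D y)) with h | h
    · exact (key2 x y h).trans (le_max_right _ _)
    · rw [add_comm]; exact (key2 y x h).trans (le_max_left _ _)

lemma valDiv_apply (x : D) : valDiv k D x = valMul k (nr k D x) := rfl

lemma valDiv_eq_exp {x : D} (hx : x ≠ 0) : valDiv k D x = WithZero.exp (-val k (nr k D x)) :=
  valMul_eq_exp (nr_ne_zero_of_isUnit (IsUnit.mk0 x hx))

lemma valDiv_le_one_iff {x : D} : valDiv k D x ≤ 1 ↔ IsIntegral 𝒪[k] x := by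
  rw [valDiv_apply, valMul_le_one_iff, isIntegral_iff_nr_mem]

/-- A maximal order of `D` is the valuation ring of `D`: its elements are integral, and the
valuation ring is itself an order. -/
lemma mem_maximalOrder_iff {Δ : Subalgebra 𝒪[k] D} (hΔ : Maximal (IsOrder k) Δ) {x : D} :
    x ∈ Δ ↔ valDiv k D x ≤ 1 := by
  let O : Subalgebra 𝒪[k] D :=
    { carrier := {x | valDiv k D x ≤ 1}
      mul_mem' := fun {x y} hx hy => by
        rw [Set.mem_ofPred_eq, map_mul]; exact mul_le_one' hx hy
      add_mem' := fun {x y} hx hy => ((valDiv k D).map_add x y).trans (max_le hx hy)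
      algebraMap_mem' := fun r => valDiv_le_one_iff.2 isIntegral_algebraMap }
  have hle : Δ ≤ O := fun x hx => by
    refine valDiv_le_one_iff.2 ?_
    have : Module.Finite 𝒪[k] Δ := Module.Finite.iff_fg.2 hΔ.prop.fg
    exact ((Algebra.IsIntegral.of_finite 𝒪[k] Δ).isIntegral ⟨x, hx⟩).map Δ.val
  have hO : IsOrder k O := by
    refine ⟨?_, ?_⟩
    · obtain ⟨Λ, hΛ, h⟩ := exists_lattice_of_norm_mem (k := k) (D := D)
      refine hΛ.of_le fun x hx => h x ?_
      rw [← nr_pow_degree]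
      exact pow_mem (valMul_le_one_iff.1 hx) _
    · rw [eq_top_iff, ← hΔ.prop.span_eq_top]
      exact Submodule.span_mono hle
  exact ⟨fun h => hle h, fun h => hΔ.le_of_ge hO hle h⟩

lemma valDiv_uniformizer {ϖ : Dˣ} {π : 𝒪[k]} (hπ : Irreducible π)
    (hϖ : (ϖ : D) ^ degree k D = algebraMap k D (π : k)) : valDiv k D ϖ = WithZero.exp (-1) := by
  have hπ0 : (π : k) ≠ 0 := fun h => hπ.ne_zero (Subtype.ext h)
  have hm := degree_pos k (A := D)
  have h0 := nr_ne_zero_of_isUnit (k := k) ϖ.isUnit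
  rw [valDiv_eq_exp ϖ.ne_zero]
  have h := congrArg (val k) (congrArg (nrHom k D) hϖ)
  rw [map_pow, nrHom_apply, nrHom_apply, nr_algebraMap, val_pow h0, val_pow hπ0, val_irreducible hπ]
    at h
  rw [mul_left_cancel₀ (by exact_mod_cast hm.ne') h]

end

/-! ### The residue field of the division algebra -/

lemma lt_exp_iff_le_exp_sub_one {a : ℤᵐ⁰} {c : ℤ} :
    a < WithZero.exp c ↔ a ≤ WithZero.exp (c - 1) := by
  rcases eq_or_ne a 0 with rfl | ha
  · simp
  · rw [← WithZero.exp_log ha, WithZero.exp_lt_exp, WithZero.exp_le_exp]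
    omega

universe v

section
variable {k : Type*} [Field k] [CharZero k] [ValuativeRel k] [TopologicalSpace k]
  [IsNonarchimedeanLocalField k]
variable {D : Type v} [DivisionRing D] [Algebra k D] [FiniteDimensional k D] [Algebra.IsCentral k D]

lemma valDiv_algebraMap_le_one (r : 𝒪[k]) : valDiv k D (algebraMap 𝒪[k] D r) ≤ 1 :=
  valDiv_le_one_iff.2 isIntegral_algebraMap

lemma valDiv_algebraMap_lt_one {r : 𝒪[k]} (hr : r ∈ 𝓂[k]) :
    valDiv k D (algebraMap 𝒪[k] D r) < 1 := by
  rcases eq_or_ne r 0 with rfl | hr0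
  · simp
  refine lt_of_le_of_ne (valDiv_algebraMap_le_one r) fun h => ?_
  have h1 : algebraMap 𝒪[k] D r = algebraMap k D (r : k) := rfl
  have hr0' : (r : k) ≠ 0 := fun h => hr0 (Subtype.ext h)
  rw [h1, valDiv_apply, nr_algebraMap, valMul_eq_exp (pow_ne_zero _ hr0'), val_pow hr0',
    ← WithZero.exp_zero, WithZero.exp_inj, neg_eq_zero, mul_eq_zero, Nat.cast_eq_zero] at h
  obtain ⟨u, hu⟩ := exists_unit_of_val_eq_zero hr0' (h.resolve_left (degree_pos k (A := D)).ne')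
  exact (IsLocalRing.mem_maximalIdeal r).1 hr ((Subtype.ext hu : (u : 𝒪[k]) = r) ▸ u.isUnit)

/-- The residue ring of the maximal order is finite and without zero divisors, hence a field by
Wedderburn's theorem. -/
lemma exists_residueField {Δ : Subalgebra 𝒪[k] D} (hΔ : Maximal (IsOrder k) Δ) :
    ∃ (F : Type v) (_ : Field F) (_ : Finite F) (ρ : Δ →+* F), Function.Surjective ρ ∧
      ∀ x, ρ x = 0 ↔ valDiv k D x < 1 := by
  let P : Ideal Δ :=
    { carrier := {x | valDiv k D x < 1}
      add_mem' := fun {x y} hx hy => (valDiv k D).map_add_lt hx hy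
      zero_mem' := by simp
      smul_mem' := fun c x hx => by
        rw [Set.mem_ofPred_eq, smul_eq_mul, Subalgebra.coe_mul, map_mul]
        exact (mul_le_of_le_one_left' ((mem_maximalOrder_iff hΔ).1 c.2)).trans_lt hx }
  have hP : ∀ x, x ∈ P ↔ valDiv k D x < 1 := fun x => Iff.rfl
  have : P.IsTwoSided := ⟨fun {a} b ha => by
    rw [hP, Subalgebra.coe_mul, map_mul]
    exact (mul_le_of_le_one_right' ((mem_maximalOrder_iff hΔ).1 b.2)).trans_lt ha⟩
  let F := Δ ⧸ P
  have hρ : ∀ x, Ideal.Quotient.mk P x = 0 ↔ valDiv k D x < 1 := fun x =>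
    Ideal.Quotient.eq_zero_iff_mem
  have hnt : Nontrivial F := by
    refine ⟨1, 0, fun h => ?_⟩
    have := (hρ 1).1 (by rw [map_one]; exact h)
    simp at this
  have hdom : NoZeroDivisors F := ⟨fun {a b} hab => by
    obtain ⟨a, rfl⟩ := Ideal.Quotient.mk_surjective a
    obtain ⟨b, rfl⟩ := Ideal.Quotient.mk_surjective b
    rw [← map_mul, hρ] at hab
    rw [hρ, hρ]
    by_contra! h
    rw [Subalgebra.coe_mul, map_mul] at hab
    exact (one_le_mul_of_one_le_of_one_le h.1 h.2).not_gt hab⟩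
  have : IsDomain F := NoZeroDivisors.to_isDomain F
  have hfin : Finite F := by
    have : Module.Finite 𝒪[k] Δ := Module.Finite.iff_fg.2 hΔ.prop.fg
    have hker : ∀ r ∈ 𝓂[k], ((Ideal.Quotient.mk P).comp (algebraMap 𝒪[k] Δ)) r = 0 := fun r hr =>
      (hρ _).2 (valDiv_algebraMap_lt_one hr)
    let ι : 𝓀[k] →+* F := Ideal.Quotient.lift 𝓂[k] ((Ideal.Quotient.mk P).comp (algebraMap 𝒪[k] Δ))
        hker
    let _ : Module 𝓀[k] F := Module.compHom F ι
    obtain ⟨N, s, hs⟩ := Module.Finite.exists_fin (R := 𝒪[k]) (M := Δ)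
    have : Module.Finite 𝓀[k] F := by
      refine Module.finite_def.2 (Submodule.fg_def.2
        ⟨Set.range (Ideal.Quotient.mk P ∘ s), Set.finite_range _, eq_top_iff.2 fun x _ => ?_⟩)
      obtain ⟨x, rfl⟩ := Ideal.Quotient.mk_surjective x
      obtain ⟨r, rfl⟩ := (Submodule.mem_span_range_iff_exists_fun 𝒪[k]).1
        (hs ▸ Submodule.mem_top : x ∈ Submodule.span 𝒪[k] (Set.range s))
      rw [map_sum]
      refine Submodule.sum_mem _ fun i _ => ?_
      have h : Ideal.Quotient.mk P (r i • s i) =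
          IsLocalRing.residue 𝒪[k] (r i) • Ideal.Quotient.mk P (s i) := by
        rw [Algebra.smul_def, map_mul]
        rfl
      rw [h]
      exact Submodule.smul_mem _ _ (Submodule.subset_span ⟨i, rfl⟩)
    exact Module.finite_of_finite 𝓀[k]
  let _ : Field F := (Finite.isDomain_to_isField F).toField
  exact ⟨F, inferInstance, hfin, Ideal.Quotient.mk P, Ideal.Quotient.mk_surjective, hρ⟩

end

/-! ### Hensel's lemma in a finite extension of a complete discrete valuation ring -/

section
open Polynomial

/-- A commutative domain that is a finitely generated module over a complete discrete valuation ring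
`(R, π)` is `π`-adically complete. -/
lemma isAdicComplete_of_finite {R S : Type*} [CommRing R] [IsDomain R] [IsDiscreteValuationRing R]
    [IsAdicComplete (IsLocalRing.maximalIdeal R) R] [CommRing S] [IsDomain S] [Algebra R S]
        [Module.Finite R S]
    {π : R} (hπ : Irreducible π) (hu : ¬ IsUnit (algebraMap R S π)) :
    IsAdicComplete (Ideal.span {algebraMap R S π}) S := by
  have : IsNoetherianRing S := IsNoetherianRing.of_finite R S
  have : IsHausdorff (Ideal.span {algebraMap R S π}) S := IsHausdorff.of_isDomain _ (by
    rwa [Ne, Ideal.span_singleton_eq_top])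
  have : IsPrecomplete (Ideal.span {algebraMap R S π}) S := by
    refine ⟨fun f hf => ?_⟩
    obtain ⟨N, s, hs⟩ := Module.Finite.exists_fin (R := R) (M := S)
    have hstep : ∀ n, ∃ r : Fin N → R, f (n + 1) = f n + ∑ j, (π ^ n * r j) • s j := by
      intro n
      have h := hf n.le_succ
      rw [SModEq.sub_mem, smul_eq_mul, Ideal.mul_top, Ideal.span_singleton_pow,
        Ideal.mem_span_singleton] at h
      obtain ⟨c, hc⟩ := h
      obtain ⟨r, hr⟩ := (Submodule.mem_span_range_iff_exists_fun R).1 (hs ▸ Submodule.mem_top :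
        c ∈ Submodule.span R (Set.range s))
      refine ⟨fun j => - r j, ?_⟩
      rw [sub_eq_iff_eq_add] at hc
      have h2 : algebraMap R S π ^ n * c = ∑ j, (π ^ n * r j) • s j := by
        rw [← hr, Finset.mul_sum]
        refine Finset.sum_congr rfl fun j _ => ?_
        rw [mul_smul_comm, ← map_pow, ← Algebra.smul_def, smul_smul, mul_comm]
      rw [hc, h2]
      simp only [mul_neg, neg_smul, Finset.sum_neg_distrib]
      abel
    choose r hr using hstep
    have hsum : ∀ n, f n = f 0 + ∑ j, (∑ i ∈ Finset.range n, π ^ i * r i j) • s j := by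
      intro n
      induction n with
      | zero => simp
      | succ n ih =>
        simp_rw [hr, ih, Finset.sum_range_succ, add_smul, Finset.sum_add_distrib, add_assoc]
    have hL : ∀ j, ∃ L : R, ∀ n, π ^ n ∣ (∑ i ∈ Finset.range n, π ^ i * r i j) - L := by
      intro j
      obtain ⟨L, hL⟩ := IsPrecomplete.prec (I := IsLocalRing.maximalIdeal R) inferInstance
        (f := fun n => ∑ i ∈ Finset.range n, π ^ i * r i j) (by
          intro m n hmn
          rw [SModEq.sub_mem, smul_eq_mul, Ideal.mul_top, hπ.maximalIdeal_eq,
            Ideal.span_singleton_pow, Ideal.mem_span_singleton,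
            ← Finset.sum_range_add_sum_Ico _ hmn]
          simp only [sub_add_cancel_left, dvd_neg]
          exact Finset.dvd_sum fun i hi => (pow_dvd_pow _ (Finset.mem_Ico.1 hi).1).mul_right _)
      refine ⟨L, fun n => ?_⟩
      have := hL n
      rwa [SModEq.sub_mem, smul_eq_mul, Ideal.mul_top, hπ.maximalIdeal_eq, Ideal.span_singleton_pow,
        Ideal.mem_span_singleton] at this
    choose L hL using hL
    refine ⟨f 0 + ∑ j, L j • s j, fun n => ?_⟩
    rw [SModEq.sub_mem, smul_eq_mul, Ideal.mul_top, Ideal.span_singleton_pow,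
      Ideal.mem_span_singleton, hsum,
      add_sub_add_left_eq_sub, ← Finset.sum_sub_distrib]
    refine Finset.dvd_sum fun j _ => ?_
    rw [← sub_smul, Algebra.smul_def, ← map_pow]
    exact (_root_.map_dvd _ (hL j n)).mul_right _
  exact ⟨⟩

/-- If `z` is a root of `p`, then every monic `f` with the same separable reduction as `p` has
a root as well: `z` is an approximate simple root of `f`, and Hensel's lemma applies. -/
lemma exists_root_of_map_eq {R S : Type*} [CommRing R] [IsDomain R] [IsDiscreteValuationRing R]
    [IsAdicComplete (IsLocalRing.maximalIdeal R) R] [CommRing S] [IsDomain S] [Algebra R S]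
        [Module.Finite R S]
    {π : R} (hπ : Irreducible π) (hu : ¬ IsUnit (algebraMap R S π))
    {p f : R[X]} (hf : f.Monic) (hpf :
        p.map (IsLocalRing.residue R) = f.map (IsLocalRing.residue R))
    (hsep : (f.map (IsLocalRing.residue R)).Separable) {z : S} (hz : aeval z p = 0) :
    ∃ a : S, aeval a f = 0 := by
  have := isAdicComplete_of_finite hπ hu
  set I := Ideal.span {algebraMap R S π}
  have hker : IsLocalRing.maximalIdeal R ≤ I.comap (algebraMap R S) := by
    rw [hπ.maximalIdeal_eq, Ideal.span_singleton_le_iff_mem]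
    exact Ideal.mem_span_singleton_self _
  let ψ : IsLocalRing.ResidueField R →+* S ⧸ I := Ideal.quotientMap I (algebraMap R S) hker
  have hψ : ∀ q : R[X], Ideal.Quotient.mk I (aeval z q) =
      (q.map (IsLocalRing.residue R)).eval₂ ψ (Ideal.Quotient.mk I z) := by
    intro q
    rw [eval₂_map, aeval_def, hom_eval₂]
    rfl
  have hfz : Ideal.Quotient.mk I (aeval z f) = 0 := by
    rw [hψ, ← hpf, ← hψ, hz, map_zero]
  obtain ⟨a, ha, -⟩ := HenselianRing.is_henselian (I := I) (f.map (algebraMap R S)) (hf.map _) z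
    (by rw [eval_map_algebraMap]; exact Ideal.Quotient.eq_zero_iff_mem.1 hfz)
    (by
      rw [derivative_map, eval_map_algebraMap, hψ, ← derivative_map]
      obtain ⟨A, B, h⟩ := hsep
      have h1 := congrArg (eval₂ ψ (Ideal.Quotient.mk I z)) h
      rw [eval₂_add, eval₂_mul, eval₂_mul, ← hψ f, hfz, mul_zero, zero_add, eval₂_one] at h1
      exact IsUnit.of_mul_eq_one_right _ h1)
  exact ⟨a, by rw [← eval_map_algebraMap]; exact ha⟩

end

/-! ### Surjectivity of the reduced norm on units -/

section
open Polynomial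
variable {k : Type*} [Field k] [CharZero k] [ValuativeRel k] [TopologicalSpace k]
  [IsNonarchimedeanLocalField k]
variable {D : Type v} [DivisionRing D] [Algebra k D] [FiniteDimensional k D] [Algebra.IsCentral k D]

variable {Δ : Subalgebra 𝒪[k] D} {F : Type v} [Field F] [Algebra 𝓀[k] F] {ρ : Δ →+* F}

/-- The residue field of `D` has degree at least `m = deg D` over that of `k`: if the `b_j` lift a
basis, the elements `b_j ϖ ^ i` with `i < m` generate `Δ`, which has rank `m ^ 2`. -/
lemma degree_le_finrank_residueField (hΔ : Maximal (IsOrder k) Δ) [Module.Finite 𝓀[k] F]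
    (hsurj : Function.Surjective ρ) (hker : ∀ x, ρ x = 0 ↔ valDiv k D x < 1)
    (hρ : ∀ r : 𝒪[k], ρ (algebraMap 𝒪[k] Δ r) = algebraMap 𝓀[k] F (IsLocalRing.residue 𝒪[k] r))
    {ϖ : Dˣ} {π : 𝒪[k]} (hπ : Irreducible π)
    (hϖ : (ϖ : D) ^ degree k D = algebraMap k D (π : k)) :
    degree k D ≤ Module.finrank 𝓀[k] F := by
  set e := Module.finrank 𝓀[k] F
  let b := Module.finBasis 𝓀[k] F
  choose b' hb' using fun j => hsurj (b j)
  let g : Fin e × Fin (degree k D) → D := fun q => b' q.1 * (ϖ : D) ^ (q.2 : ℕ)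
  have hϖv := valDiv_uniformizer hπ hϖ
  -- division with remainder by `ϖ`
  have hstep : ∀ x ∈ Δ, ∃ (r : Fin e → 𝒪[k]), ∃ y ∈ Δ, x = ∑ j, r j • (b' j : D) + y * ϖ := by
    intro x hx
    choose r hr using fun j => IsLocalRing.residue_surjective (b.repr (ρ ⟨x, hx⟩) j)
    refine ⟨r, (x - ∑ j, r j • (b' j : D)) * ((ϖ⁻¹ : Dˣ) : D), ?_,
      by rw [Units.inv_mul_cancel_right]; abel⟩
    rw [mem_maximalOrder_iff hΔ, map_mul, Units.val_inv_eq_inv_val, map_inv₀, hϖv]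
    have h1 : ρ (⟨x, hx⟩ - ∑ j, r j • b' j) = 0 := by
      rw [map_sub, map_sum, sub_eq_zero]
      conv_lhs => rw [← b.sum_repr (ρ ⟨x, hx⟩)]
      refine Finset.sum_congr rfl fun j _ => ?_
      rw [Algebra.smul_def (r j), map_mul, hρ, hr, hb', Algebra.smul_def]
    rw [hker] at h1
    have h2 : ((⟨x, hx⟩ - ∑ j, r j • b' j : Δ) : D) = x - ∑ j, r j • (b' j : D) := by simp
    rw [h2, ← WithZero.exp_zero, lt_exp_iff_le_exp_sub_one] at h1
    rw [← WithZero.exp_neg]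
    refine (mul_le_mul_left h1 _).trans ?_
    rw [← WithZero.exp_add]
    simp
  have hiter : ∀ i ≤ degree k D, ∀ x ∈ Δ, ∃ y ∈ Δ, ∃ s ∈ Submodule.span 𝒪[k] (Set.range g),
      x = s + y * (ϖ : D) ^ i := by
    intro i
    induction i with
    | zero => exact fun _ x hx => ⟨x, hx, 0, zero_mem _, by simp⟩
    | succ i ih =>
      intro hi x hx
      obtain ⟨y, hy, s, hs, rfl⟩ := ih (by omega) x hx
      obtain ⟨r, y', hy', rfl⟩ := hstep y hy
      refine ⟨y', hy', s + ∑ j, r j • (b' j * (ϖ : D) ^ i),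
        add_mem hs (Submodule.sum_mem _ fun j _ =>
        Submodule.smul_mem _ _ (Submodule.subset_span ⟨(j, ⟨i, by omega⟩), rfl⟩)), ?_⟩
      rw [add_mul, Finset.sum_mul, pow_succ', mul_assoc, add_assoc]
      simp only [smul_mul_assoc]
  have hle : Subalgebra.toSubmodule Δ ≤ Submodule.span 𝒪[k] (Set.range g) := by
    refine Submodule.le_of_le_smul_of_le_jacobson_bot (I := 𝓂[k]) hΔ.prop.fg
      (IsLocalRing.maximalIdeal_le_jacobson _) fun x hx => ?_
    obtain ⟨y, hy, s, hs, rfl⟩ := hiter _ le_rfl x hx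
    refine Submodule.add_mem_sup hs ?_
    rw [hϖ, ← Algebra.commutes, ← Algebra.smul_def]
    exact Submodule.smul_mem_smul (r := π) ((IsLocalRing.mem_maximalIdeal _).2 hπ.not_isUnit) hy
  have htop : Submodule.span k (Set.range g) = ⊤ := by
    rw [eq_top_iff, ← hΔ.prop.span_eq_top, Submodule.span_le]
    intro x hx
    exact Submodule.span_le_restrictScalars 𝒪[k] k (Set.range g) (hle hx)
  have hcard : Module.finrank k D ≤ e * degree k D := by
    have := finrank_range_le_card (R := k) (b := g)
    rw [Set.finrank, htop, finrank_top] at this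
    simpa using this
  rw [(exists_splitting (k := k) (A := D) (AlgebraicClosure k)).1, sq] at hcard
  exact Nat.le_of_mul_le_mul_right hcard (degree_pos k)

/-- If the residue `ζ` of `z` has degree at least `deg D` over the residue field of `k`, then every
element of `R` whose residue is `(-1) ^ deg ζ` times the constant coefficient of the minimal
polynomial of `ζ` is a reduced norm: it is the reduced norm, by Hensel's lemma, of a root in `R[z]`
of the lift of that polynomial with the corresponding constant coefficient. -/
lemma exists_nr_eq_of_residue_eq (hΔ : Maximal (IsOrder k) Δ) [Finite F]
    (hρ : ∀ r : 𝒪[k], ρ (algebraMap 𝒪[k] Δ r) = algebraMap 𝓀[k] F (IsLocalRing.residue 𝒪[k] r))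
    {π : 𝒪[k]} (hπ : Irreducible π) (z : Δ) (hdeg : degree k D ≤ (minpoly 𝓀[k] (ρ z)).natDegree)
    {u : 𝒪[k]} (hu : IsLocalRing.residue 𝒪[k] u =
      (-1) ^ (minpoly 𝓀[k] (ρ z)).natDegree * (minpoly 𝓀[k] (ρ z)).coeff 0) :
    ∃ a : D, nr k D a = u := by
  have : Module.Finite 𝓀[k] F := Module.Finite.of_finite
  set q := minpoly 𝓀[k] (ρ z)
  have hint : IsIntegral 𝓀[k] (ρ z) := Algebra.IsIntegral.isIntegral _
  have hq : q.Monic := minpoly.monic hint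
  have hzint : IsIntegral 𝒪[k] (z : D) := valDiv_le_one_iff.1 ((mem_maximalOrder_iff hΔ).1 z.2)
  -- the minimal polynomial of `z` over `k` has integral coefficients and reduces to `q`
  obtain ⟨p, hpm, hp⟩ : ∃ p : 𝒪[k][X], p.Monic ∧ p.map (algebraMap 𝒪[k] k) = minpoly k (z : D) := by
    obtain ⟨f, hf, hfz⟩ := hzint
    have hdvd : minpoly k (z : D) ∣ f.map (algebraMap 𝒪[k] k) :=
      minpoly.dvd _ _ (by rw [aeval_map_algebraMap]; exact hfz)
    obtain ⟨p, hp⟩ := IsIntegrallyClosed.eq_map_mul_C_of_dvd k hf hdvd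
    rw [(minpoly.monic (Algebra.IsIntegral.isIntegral (R := k) (z : D))).leadingCoeff, C_1, mul_one]
      at hp
    refine ⟨p, ?_, hp⟩
    exact monic_of_injective (IsFractionRing.injective 𝒪[k] k)
      (hp ▸ minpoly.monic (Algebra.IsIntegral.isIntegral (R := k) (z : D)))
  have hpz : aeval (z : D) p = 0 := by
    rw [← aeval_map_algebraMap k, hp, minpoly.aeval]
  have hpz' : aeval z p = 0 := Subtype.ext ((aeval_algHom_apply Δ.val z p).symm.trans hpz)
  have hpdeg : p.natDegree ≤ degree k D := by
    rw [← hpm.natDegree_map (algebraMap 𝒪[k] k), hp]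
    exact natDegree_minpoly_le _
  have hpq : p.map (IsLocalRing.residue 𝒪[k]) = q := by
    refine (eq_of_monic_of_dvd_of_natDegree_le hq (hpm.map _) (minpoly.dvd _ _ ?_) ?_)
    · rw [aeval_def, eval₂_map]
      have h := congrArg ρ hpz'
      rw [aeval_def, hom_eval₂, map_zero] at h
      rw [← h]
      congr 1
      ext r
      exact (hρ r).symm
    · rw [hpm.natDegree_map]
      exact hpdeg.trans hdeg
  have hqdeg : q.natDegree = degree k D := by
    refine le_antisymm ?_ hdeg
    rw [← hpq, hpm.natDegree_map]
    exact hpdeg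
  have hm := degree_pos k (A := D)
  -- change the constant coefficient of `p` to `± u`
  let f : 𝒪[k][X] := p + C ((-1) ^ degree k D * u - p.coeff 0)
  have hpdeg' : p.natDegree = degree k D := by
    rw [← hqdeg, ← hpq, hpm.natDegree_map]
  have hf : f.Monic := hpm.add_of_left
      (lt_of_le_of_lt degree_C_le (natDegree_pos_iff_degree_pos.1 (by omega)))
  have hfq : f.map (IsLocalRing.residue 𝒪[k]) = q := by
    have : IsLocalRing.residue 𝒪[k] ((-1) ^ degree k D * u - p.coeff 0) = 0 := by
      rw [map_sub, map_mul, hu, ← coeff_map, hpq, hqdeg, map_pow, map_neg, map_one, ← mul_assoc,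
        ← mul_pow]
      simp
    rw [Polynomial.map_add, hpq, map_C, this, C_0, add_zero]
  have hfdeg : f.natDegree = degree k D := by
    rw [← hqdeg, ← hfq, hf.natDegree_map]
  have hf0 : f.coeff 0 = (-1) ^ degree k D * u := by
    rw [coeff_add, coeff_C_zero]; ring
  have hfirr : Irreducible f := hf.irreducible_of_irreducible_map (IsLocalRing.residue 𝒪[k]) _
    (hfq ▸ minpoly.irreducible hint)
  have hfirr' : Irreducible (f.map (algebraMap 𝒪[k] k)) :=
    (hf.irreducible_iff_irreducible_map_fraction_map).1 hfirr
  have hsep : q.Separable := PerfectField.separable_of_irreducible (minpoly.irreducible hint)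
  -- Hensel's lemma in `R[z]`
  let S := Algebra.adjoin 𝒪[k] {(z : D)}
  have := Algebra.isMulCommutative_adjoin 𝒪[k] (s := {(z : D)}) (by simp)
  have hS : S ≤ Δ := Algebra.adjoin_le (Set.singleton_subset_iff.2 z.2)
  have : Module.Finite 𝒪[k] S :=
    Module.Finite.iff_fg.2 (hΔ.prop.fg.of_le (Subalgebra.toSubmodule.monotone hS))
  have : IsDomain S := inferInstance
  have : IsAdicComplete (IsLocalRing.maximalIdeal 𝒪[k]) 𝒪[k] := by
    let := IsTopologicalAddGroup.rightUniformSpace k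
    have := isUniformAddGroup_of_addCommGroup (G := k)
    infer_instance
  have hu : ¬ IsUnit (algebraMap 𝒪[k] S π) := by
    intro h
    obtain ⟨y, hy⟩ := h.exists_right_inv
    have h1 : algebraMap 𝒪[k] D π * (y : D) = 1 := congrArg Subtype.val hy
    have h2 := congrArg (valDiv k D) h1
    rw [map_mul, map_one] at h2
    exact (mul_lt_one_of_lt_of_le
      (valDiv_algebraMap_lt_one ((IsLocalRing.mem_maximalIdeal _).2 hπ.not_isUnit))
      ((mem_maximalOrder_iff hΔ).1 (hS y.2))).ne h2
  let z' : S := ⟨z, Algebra.self_mem_adjoin_singleton _ _⟩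
  obtain ⟨a, ha⟩ := exists_root_of_map_eq (S := S) hπ hu hf (hpq.trans hfq.symm) (hfq.symm ▸ hsep)
    (z := z')
    (Subtype.ext ((aeval_algHom_apply S.val z' p).symm.trans hpz))
  refine ⟨a, ?_⟩
  rw [nr_eq_of_aeval_eq_zero (hf.map (algebraMap 𝒪[k] k)) hfirr'
    (by rw [hf.natDegree_map, hfdeg]) (a := (a : D)), coeff_map, hf0]
  · rw [map_mul, ← mul_assoc, map_pow, map_neg, map_one, ← mul_pow]
    simp
    rfl
  · rw [aeval_map_algebraMap, show (a : D) = S.val a from rfl, aeval_algHom_apply, ha, map_zero]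

/-- The units of `R` are reduced norms: those whose residue is the norm of a generator `ζ` of the
multiplicative group of the residue field are, and a unit with residue `N(ζ) ^ j` is the product of
one such unit and the `(j - 1)`-st power of another. -/
theorem exists_nr_eq_unit (hΔ : Maximal (IsOrder k) Δ)
    {ϖ : Dˣ} {π : 𝒪[k]} (hπ : Irreducible π)
    (hϖ : (ϖ : D) ^ degree k D = algebraMap k D (π : k)) (u : 𝒪[k]ˣ) :
    ∃ a : D, nr k D a = ((u : 𝒪[k]) : k) := by
  obtain ⟨F, _, _, ρ, hsurj, hker⟩ := exists_residueField hΔ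
  let _ : Algebra 𝓀[k] F := (Ideal.Quotient.lift 𝓂[k] (ρ.comp (algebraMap 𝒪[k] Δ)) fun r hr =>
    (hker _).2 (valDiv_algebraMap_lt_one hr)).toAlgebra
  have hρ : ∀ r : 𝒪[k], ρ (algebraMap 𝒪[k] Δ r) = algebraMap 𝓀[k] F (IsLocalRing.residue 𝒪[k] r) :=
    fun r => rfl
  have : Module.Finite 𝓀[k] F := Module.Finite.of_finite
  have hle := degree_le_finrank_residueField hΔ hsurj hker hρ hπ hϖ
  obtain ⟨ζ, hζ⟩ := IsCyclic.exists_generator (α := Fˣ)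
  have htop : IntermediateField.adjoin 𝓀[k] {(ζ : F)} = ⊤ := by
    refine eq_top_iff.2 fun x _ => ?_
    rcases eq_or_ne x 0 with rfl | hx
    · exact zero_mem _
    · obtain ⟨j, hj⟩ := Subgroup.mem_zpowers_iff.1 (hζ (Units.mk0 x hx))
      have : x = (ζ : F) ^ j := by
        have := congrArg Units.val hj
        rw [Units.val_zpow_eq_zpow_val] at this
        exact this.symm
      rw [this]
      exact zpow_mem (IntermediateField.mem_adjoin_simple_self _ _) j
  have hint : IsIntegral 𝓀[k] (ζ : F) := Algebra.IsIntegral.isIntegral _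
  have hdeg : (minpoly 𝓀[k] (ζ : F)).natDegree = Module.finrank 𝓀[k] F := by
    rw [← IntermediateField.adjoin.finrank hint, htop, IntermediateField.finrank_top']
  have hnorm : Algebra.norm 𝓀[k] (ζ : F) = (-1) ^ (minpoly 𝓀[k] (ζ : F)).natDegree *
      (minpoly 𝓀[k] (ζ : F)).coeff 0 := by
    have h1 : Module.finrank (IntermediateField.adjoin 𝓀[k] {(ζ : F)}) F = 1 := by
      rw [htop]; exact IntermediateField.finrank_top
    have h2 := Algebra.PowerBasis.norm_gen_eq_coeff_zero_minpoly
        (IntermediateField.adjoin.powerBasis hint)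
    rw [IntermediateField.adjoin.powerBasis_gen, IntermediateField.adjoin.powerBasis_dim,
      IntermediateField.minpoly_gen] at h2
    rw [Algebra.norm_eq_norm_adjoin, h1, pow_one, h2]
  obtain ⟨z, hz⟩ := hsurj ζ
  -- units whose residue is the norm of `ζ`
  have key : ∀ u : 𝒪[k], IsLocalRing.residue 𝒪[k] u = Algebra.norm 𝓀[k] (ζ : F) → ∃ a :
      D, nr k D a = u :=
    fun u hu => exists_nr_eq_of_residue_eq hΔ hρ hπ z
        (by rw [hz, hdeg]; exact hle) (by rw [hz, hu, hnorm])
  obtain ⟨x, hx⟩ := FiniteField.unitsMap_norm_surjective 𝓀[k] F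
    (Units.map (IsLocalRing.residue 𝒪[k]).toMonoidHom u)
  obtain ⟨j, rfl⟩ := Subgroup.mem_zpowers_iff.1 (hζ x)
  obtain ⟨u₀, hu₀⟩ := IsLocalRing.surjective_units_map_of_local_ringHom (IsLocalRing.residue 𝒪[k])
    IsLocalRing.residue_surjective inferInstance (Units.map (Algebra.norm 𝓀[k]) ζ)
  obtain ⟨a₀, ha₀⟩ := key u₀ (congrArg Units.val hu₀)
  obtain ⟨a₁, ha₁⟩ := key (u * u₀ ^ (1 - j) : 𝒪[k]ˣ) (by
    have : Units.map (IsLocalRing.residue 𝒪[k]).toMonoidHom (u * u₀ ^ (1 - j)) = Units.map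
        (Algebra.norm 𝓀[k]) ζ := by
      rw [map_mul, ← hx, map_zpow, map_zpow]
      erw [hu₀]
      rw [← zpow_add]
      simp
    exact congrArg Units.val this)
  have hu0 : ((u₀ : 𝒪[k]) : k) ≠ 0 := fun h => u₀.ne_zero (Subtype.ext h)
  have ha0 : a₀ ≠ 0 := by
    rintro rfl
    exact hu0 (by rw [← ha₀, nr_zero])
  refine ⟨a₁ * ((Units.mk0 a₀ ha0 ^ (j - 1) : Dˣ) : D), ?_⟩
  have h1 : nr k D ((Units.mk0 a₀ ha0 ^ (j - 1) : Dˣ) : D) = ((u₀ : 𝒪[k]) : k) ^ (j - 1) := by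
    rw [← ha₀]
    have := congrArg Units.val (map_zpow (Units.map (nrHom k D)) (Units.mk0 a₀ ha0) (j - 1))
    rw [Units.val_zpow_eq_zpow_val] at this
    exact this
  have h2 : ((u₀ : 𝒪[k]) : k) ^ (j - 1) = (((u₀ ^ (j - 1) : 𝒪[k]ˣ) : 𝒪[k]) : k) := by
    have := congrArg Units.val (map_zpow (Units.map (algebraMap 𝒪[k] k).toMonoidHom) u₀ (j - 1))
    rw [Units.val_zpow_eq_zpow_val] at this
    exact this.symm
  rw [nr_mul, ha₁, h1, h2, ← Subring.coe_mul, ← Units.val_mul, mul_assoc, ← zpow_add]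
  simp

end

/-! ### The normalizer of a tiled order consists of monomial matrices times units -/

section
variable {D : Type*} [DivisionRing D] {n : ℕ} (V : Valuation D ℤᵐ⁰)

/-- The set `(𝔭 ^ μ_{ij})` of matrices attached to an exponent matrix `μ`, where `𝔭 ^ c` is the set
of elements of additive valuation at least `c`. -/
def tiled (μ : Matrix (Fin n) (Fin n) ℤ) : Set (Matrix (Fin n) (Fin n) D) :=
  {x | ∀ i j, V (x i j) ≤ WithZero.exp (-μ i j)}

/-- The additive valuation attached to `V`, with junk value `0` at `0`. -/
def ord (x : D) : ℤ := -WithZero.log (V x)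

variable {V}

lemma valuation_eq_exp {x : D} (hx : x ≠ 0) : V x = WithZero.exp (-ord V x) := by
  rw [ord, neg_neg, WithZero.exp_log (by simpa using hx)]

lemma ord_mul {x y : D} (hx : x ≠ 0) (hy : y ≠ 0) : ord V (x * y) = ord V x + ord V y := by
  rw [ord, map_mul, WithZero.log_mul (by simpa using hx) (by simpa using hy), ord, ord]
  ring

lemma valuation_zpow {ϖ : Dˣ} (hϖ : V ϖ = WithZero.exp (-1)) (c : ℤ) :
    V ((ϖ ^ c : Dˣ) : D) = WithZero.exp (-c) := by
  rw [Units.val_zpow_eq_zpow_val, map_zpow₀, hϖ, ← WithZero.exp_zsmul]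
  simp

lemma monomial_apply (ϖ : Dˣ) (α : Fin n → ℤ) (σ : Equiv.Perm (Fin n)) (i j : Fin n) :
    (monomial ϖ α σ : Matrix (Fin n) (Fin n) D) i j =
      if σ i = j then ((ϖ ^ α i : Dˣ) : D) else 0 := rfl

lemma monomial_inv_apply (ϖ : Dˣ) (α : Fin n → ℤ) (σ : Equiv.Perm (Fin n)) (i j : Fin n) :
    (((monomial ϖ α σ)⁻¹ : (Matrix (Fin n) (Fin n) D)ˣ) : Matrix (Fin n) (Fin n) D) i j =
      if σ j = i then ((ϖ ^ (-α j) : Dˣ) : D) else 0 := rfl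

variable {μ : Matrix (Fin n) (Fin n) ℤ} {ϖ : Dˣ}

/-- The valuative content of `ξ T η ⊆ T` for `T = (𝔭 ^ μ_{ij})`, obtained from the elements
`ϖ ^ μ_{ab} e_{ab}` of `T`. -/
lemma le_ord_add_of_conj_mem (hϖ : V ϖ = WithZero.exp (-1)) {ξ η : Matrix (Fin n) (Fin n) D}
    (h : ∀ x ∈ tiled V μ, ξ * x * η ∈ tiled V μ) {i a b j : Fin n} (h1 : ξ i a ≠ 0) (h2 :
        η b j ≠ 0) :
    μ i j ≤ ord V (ξ i a) + μ a b + ord V (η b j) := by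
  have hx : Matrix.single a b ((ϖ ^ μ a b : Dˣ) : D) ∈ tiled V μ := by
    intro i' j'
    rw [Matrix.single_apply]
    split_ifs with h
    · rw [valuation_zpow hϖ, h.1, h.2]
    · simp
  have h3 := h _ hx i j
  have h4 : (ξ * Matrix.single a b ((ϖ ^ μ a b : Dˣ) : D) * η) i j = ξ i a * ((ϖ ^ μ a b : Dˣ) :
      D) * η b j := by
    rw [Matrix.mul_apply, Finset.sum_eq_single b, Matrix.mul_single_apply_same]
    · intro b' _ hb'
      rw [Matrix.mul_single_apply_of_ne _ _ _ _ _ hb', zero_mul]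
    · simp
  rw [h4, map_mul, map_mul, valuation_zpow hϖ, valuation_eq_exp h1, valuation_eq_exp h2,
    ← WithZero.exp_add,
    ← WithZero.exp_add, WithZero.exp_le_exp] at h3
  omega

/-- Two indices are equivalent when the corresponding indecomposable projective modules of
`(𝔭 ^ μ_{ij})` are isomorphic, which in terms of the exponents is `μ_{ab} + μ_{ba} = 0`. -/
def IndexEquiv (μ : Matrix (Fin n) (Fin n) ℤ) (a b : Fin n) : Prop := μ a b + μ b a = 0

/-- The conditions on `μ` for `(𝔭 ^ μ_{ij})` to be a ring containing the diagonal matrices over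
`Δ`: `μ_{ii} = 0` and the triangle inequality. -/
structure IsExponentMatrix (μ : Matrix (Fin n) (Fin n) ℤ) : Prop where
  diag : ∀ i, μ i i = 0
  triangle : ∀ i j l, μ i l ≤ μ i j + μ j l

/-- Let `ξ` and `η = ξ⁻¹` normalize `(𝔭 ^ μ_{ij})`, which enters through the inequalities `h1` and
`h2`, and let `τ` pick for each `a` a term `η_{a τ(a)} ξ_{τ(a) a}` of valuation zero. Then `τ` is a
permutation up to equivalence of indices, by Hall's marriage theorem. If a set `S` of indices
violated the marriage condition, some vector `x ≠ 0` supported on `S` would have `(x η)_b = 0` for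
all `b` equivalent to an element of `τ(S)`; writing `x = (x η) ξ`, every remaining term in the
coordinate `x_{a'}` that is minimal for a suitable weight has valuation strictly larger than
`x_{a'}`, which is absurd. -/
lemma exists_perm_indexEquiv (hμ : IsExponentMatrix μ) {ξ η : Matrix (Fin n) (Fin n) D}
    (hηξ : η * ξ = 1)
    (h1 : ∀ {i a b j}, ξ i a ≠ 0 → η b j ≠ 0 → μ i j ≤ ord V (ξ i a) + μ a b + ord V (η b j))
    (h2 : ∀ {i a b j}, η i a ≠ 0 → ξ b j ≠ 0 → μ i j ≤ ord V (η i a) + μ a b + ord V (ξ b j))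
    {τ : Fin n → Fin n} (hξ : ∀ a, ξ (τ a) a ≠ 0) (hη : ∀ a, η a (τ a) ≠ 0)
    (hτ : ∀ a, ord V (η a (τ a)) + ord V (ξ (τ a) a) = 0) :
    ∃ σ : Equiv.Perm (Fin n), ∀ a, IndexEquiv μ (σ a) (τ a) := by
  classical
  obtain ⟨f, hf, hft⟩ := (Finset.all_card_le_biUnion_card_iff_exists_injective
    (fun a => Finset.univ.filter fun b => IndexEquiv μ b (τ a))).1 (by
    intro S
    by_contra! hlt
    set T := S.biUnion fun a => Finset.univ.filter fun b => IndexEquiv μ b (τ a)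
    have hT : ∀ b ∉ T, ∀ a ∈ S, ¬ IndexEquiv μ b (τ a) := by
      intro b hb a ha h
      exact hb (Finset.mem_biUnion.2 ⟨a, ha, by simpa using h⟩)
    -- a nonzero row vector supported on `S` that kills the columns of `η` in `T`
    obtain ⟨x, hx0, hxS, hxT⟩ : ∃ x : Fin n → D, x ≠ 0 ∧
      (∀ a ∉ S, x a = 0) ∧ ∀ b ∈ T, ∑ a, x a * η a b = 0 := by
      let L : (S → D) →ₗ[D] (T → D) :=
        { toFun := fun x b => ∑ a : S, x a * η a b
          map_add' := fun x y => by ext b; simp [add_mul, Finset.sum_add_distrib]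
          map_smul' := fun c x => by ext b; simp [mul_assoc, Finset.mul_sum] }
      have hL : ¬ Function.Injective L := fun h => by
        have := LinearMap.finrank_le_finrank_of_injective h
        simp only [Module.finrank_fintype_fun_eq_card, Fintype.card_coe] at this
        omega
      obtain ⟨x, hx, hx0⟩ : ∃ x, L x = 0 ∧ x ≠ 0 := by
        by_contra! h
        exact hL ((injective_iff_map_eq_zero L).2 h)
      refine ⟨fun a => if h :
        a ∈ S then x ⟨a, h⟩ else 0, ?_, fun a ha => by simp [ha], fun b hb => ?_⟩
      · intro h
        refine hx0 (funext fun a => ?_)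
        simpa using congrFun h a
      · have := congrFun hx ⟨b, hb⟩
        rw [← Finset.sum_subset (Finset.subset_univ S) (by intro a _ ha; simp [ha]),
          ← Finset.sum_coe_sort S]
        simpa [L] using this
    -- the potential `p` satisfies `p a - p a' ≤ n μ_{aa'}`, strictly for inequivalent indices;
    -- adding it to `n` times the valuation gives the weight to be minimized
    let p : Fin n → ℤ := fun a => ∑ l, μ a l
    have hp : ∀ a a', p a ≤ n * μ a a' + p a' := by
      intro a a'
      have : p a ≤ ∑ l, (μ a a' + μ a' l) := Finset.sum_le_sum fun l _ => hμ.triangle a a' l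
      simpa [Finset.sum_add_distrib] using this
    have hp' : ∀ a a', ¬ IndexEquiv μ a a' → p a < n * μ a a' + p a' := by
      intro a a' h
      have : p a < ∑ l, (μ a a' + μ a' l) := by
        refine Finset.sum_lt_sum (fun l _ => hμ.triangle a a' l) ⟨a, Finset.mem_univ _, ?_⟩
        have h3 := hμ.triangle a a' a
        have h4 := hμ.diag a
        unfold IndexEquiv at h
        omega
      simpa [Finset.sum_add_distrib] using this
    obtain ⟨a', ha', hmin⟩ := Finset.exists_min_image (Finset.univ.filter fun a => x a ≠ 0)
      (fun a => n * ord V (x a) + p a) (by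
        obtain ⟨a, ha⟩ := Function.ne_iff.1 hx0
        exact ⟨a, by simpa using ha⟩)
    have hxa' : x a' ≠ 0 := by simpa using ha'
    have hn : (0 : ℤ) < n := by exact_mod_cast a'.pos
    have hexp : x a' = ∑ b, (∑ a, x a * η a b) * ξ b a' := by
      have h3 := congrFun (congrArg (Matrix.vecMul x) hηξ) a'
      rw [← Matrix.vecMul_vecMul, Matrix.vecMul_one] at h3
      exact h3.symm
    have hlt : V (x a') < V (x a') := by
      conv_lhs => rw [hexp]
      refine V.map_sum_lt (by simpa using hxa') fun b _ => ?_
      by_cases hb : b ∈ T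
      · rw [hxT b hb, zero_mul, map_zero, zero_lt_iff]
        simpa using hxa'
      · rw [Finset.sum_mul]
        refine V.map_sum_lt (by simpa using hxa') fun a _ => ?_
        rcases eq_or_ne (x a * η a b * ξ b a') 0 with h0 | h0
        · rw [h0, map_zero, zero_lt_iff]
          simpa using hxa'
        have hξ0 : ξ b a' ≠ 0 := right_ne_zero_of_mul h0
        have hη0 : η a b ≠ 0 := right_ne_zero_of_mul (left_ne_zero_of_mul h0)
        have hx0 : x a ≠ 0 := left_ne_zero_of_mul (left_ne_zero_of_mul h0)
        have haS : a ∈ S := by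
          by_contra h
          exact hx0 (hxS a h)
        rw [valuation_eq_exp h0, valuation_eq_exp hxa', WithZero.exp_lt_exp,
          ord_mul (left_ne_zero_of_mul h0) hξ0,
          ord_mul hx0 hη0]
        have hm := hmin a (by simpa using hx0)
        have hs := h2 hη0 hξ0
        rw [hμ.diag] at hs
        have hpos : 0 < n * (ord V (x a) + ord V (η a b) + ord V (ξ b a') - ord V (x a')) := by
          by_cases haa : IndexEquiv μ a a'
          · have hne : ord V (η a b) + ord V (ξ b a') ≠ μ a a' := by
              intro h
              refine hT b hb a haS ?_
              have h5 := h1 (hξ a) hη0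
              have h6 := h1 hξ0 (hη a)
              have h7 := hτ a
              have h8 := hμ.triangle b (τ a) b
              have h9 := hμ.diag b
              rw [hμ.diag] at h5
              unfold IndexEquiv at haa ⊢
              omega
            have h10 : μ a a' + 1 ≤ ord V (η a b) + ord V (ξ b a') := by omega
            have h11 := hp a a'
            nlinarith
          · have h11 := hp' a a' haa
            nlinarith
        have := pos_of_mul_pos_right hpos hn.le
        omega
    exact lt_irrefl _ hlt)
  refine ⟨Equiv.ofBijective f (Finite.injective_iff_bijective.1 hf), fun a => by simpa using hft a⟩

/-- An element of the normalizer of `(𝔭 ^ μ_{ij})` is the product of a monomial matrix and a unit of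
that ring. -/
theorem exists_monomial_mul_of_normalizes (hϖ : V ϖ = WithZero.exp (-1)) (hμ : IsExponentMatrix μ)
    {ξ : (Matrix (Fin n) (Fin n) D)ˣ}
    (h : ∀ x ∈ tiled V μ, (ξ : Matrix (Fin n) (Fin n) D) * x * (ξ⁻¹ :
        (Matrix (Fin n) (Fin n) D)ˣ) ∈ tiled V μ)
    (h' : ∀ x ∈ tiled V μ, ((ξ⁻¹ : (Matrix (Fin n) (Fin n) D)ˣ) :
        Matrix (Fin n) (Fin n) D) * x * ξ ∈ tiled V μ) :
    ∃ (c : Fin n → ℤ) (σ : Equiv.Perm (Fin n)) (u : (Matrix (Fin n) (Fin n) D)ˣ),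
      ξ = monomial ϖ c σ * u ∧ (u : Matrix (Fin n) (Fin n) D) ∈ tiled V μ ∧
      ((u⁻¹ : (Matrix (Fin n) (Fin n) D)ˣ) : Matrix (Fin n) (Fin n) D) ∈ tiled V μ := by
  set η : Matrix (Fin n) (Fin n) D :=
      ((ξ⁻¹ : (Matrix (Fin n) (Fin n) D)ˣ) : Matrix (Fin n) (Fin n) D) with hηdef
  have h1 : ∀ {i a b j}, (ξ : Matrix (Fin n) (Fin n) D) i a ≠ 0 → η b j ≠ 0 →
      μ i j ≤ ord V ((ξ : Matrix (Fin n) (Fin n) D) i a) + μ a b + ord V (η b j) :=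
    fun h3 h4 => le_ord_add_of_conj_mem hϖ h h3 h4
  have h2 : ∀ {i a b j}, η i a ≠ 0 → (ξ : Matrix (Fin n) (Fin n) D) b j ≠ 0 →
      μ i j ≤ ord V (η i a) + μ a b + ord V ((ξ : Matrix (Fin n) (Fin n) D) b j) :=
    fun h3 h4 => le_ord_add_of_conj_mem hϖ h' h3 h4
  have hηξ : η * ξ = 1 := Units.inv_mul ξ
  -- some term of `∑ b, η a b * ξ b a = 1` has valuation at most zero, hence exactly zero
  have hex : ∀ a, ∃ b, (ξ : Matrix (Fin n) (Fin n) D) b a ≠ 0 ∧ η a b ≠ 0 ∧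
      ord V (η a b) + ord V ((ξ : Matrix (Fin n) (Fin n) D) b a) = 0 := by
    intro a
    have hsum : ∑ b, η a b * (ξ : Matrix (Fin n) (Fin n) D) b a = 1 := by
      rw [← Matrix.mul_apply, hηξ, Matrix.one_apply_eq]
    obtain ⟨b, hb⟩ : ∃ b, 1 ≤ V (η a b * (ξ : Matrix (Fin n) (Fin n) D) b a) := by
      by_contra! hlt
      have := V.map_sum_lt one_ne_zero (s := Finset.univ) (fun b _ => hlt b)
      rw [hsum, map_one] at this
      exact lt_irrefl _ this
    have h0 : η a b * (ξ : Matrix (Fin n) (Fin n) D) b a ≠ 0 := by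
      intro h0
      rw [h0, map_zero] at hb
      simp at hb
    have hξ0 := right_ne_zero_of_mul h0
    have hη0 := left_ne_zero_of_mul h0
    refine ⟨b, hξ0, hη0, ?_⟩
    have h3 := h1 hξ0 hη0
    rw [hμ.diag, hμ.diag] at h3
    rw [valuation_eq_exp h0, ord_mul hη0 hξ0, ← WithZero.exp_zero, WithZero.exp_le_exp] at hb
    omega
  choose τ hξ hη hτ using hex
  obtain ⟨σ, hσ⟩ := exists_perm_indexEquiv hμ hηξ h1 h2 hξ hη hτ
  let c : Fin n → ℤ := fun b => ord V ((ξ : Matrix (Fin n) (Fin n) D) (τ (σ⁻¹ b)) (σ⁻¹ b)) + μ b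
      (τ (σ⁻¹ b))
  have hc : ∀ a, c (σ a) = ord V ((ξ : Matrix (Fin n) (Fin n) D) (τ a) a) + μ (σ a) (τ a) :=
      fun a => by simp [c]
  refine ⟨c, σ⁻¹, (monomial ϖ c σ⁻¹)⁻¹ * ξ, by group, ?_, ?_⟩
  · intro a j
    have he : (((monomial ϖ c σ⁻¹)⁻¹ * ξ : (Matrix (Fin n) (Fin n) D)ˣ) :
        Matrix (Fin n) (Fin n) D) a j =
        ((ϖ ^ (-c (σ a)) : Dˣ) : D) * (ξ : Matrix (Fin n) (Fin n) D) (σ a) j := by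
      rw [Units.val_mul, Matrix.mul_apply, Finset.sum_eq_single (σ a)]
      · rw [monomial_inv_apply, if_pos (by simp)]
      · intro b _ hb
        have : ¬ σ⁻¹ b = a := fun h => hb (by rw [← h]; simp)
        rw [monomial_inv_apply, if_neg this, zero_mul]
      · simp
    rcases eq_or_ne ((ξ : Matrix (Fin n) (Fin n) D) (σ a) j) 0 with h0 | h0
    · rw [he, h0, mul_zero, map_zero]; exact zero_le
    · rw [he, map_mul, valuation_zpow hϖ, valuation_eq_exp h0, ← WithZero.exp_add,
        WithZero.exp_le_exp, hc]
      have h3 := h2 (hη a) h0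
      have h4 := hτ a
      have h5 := hσ a
      unfold IndexEquiv at h5
      omega
  · intro i a
    have he : ((((monomial ϖ c σ⁻¹)⁻¹ * ξ)⁻¹ : (Matrix (Fin n) (Fin n) D)ˣ) :
        Matrix (Fin n) (Fin n) D) i a =
        η i (σ a) * ((ϖ ^ c (σ a) : Dˣ) : D) := by
      rw [mul_inv_rev, inv_inv, Units.val_mul, Matrix.mul_apply, Finset.sum_eq_single (σ a)]
      · rw [monomial_apply, if_pos (by simp)]
      · intro b _ hb
        have : ¬ σ⁻¹ b = a := fun h => hb (by rw [← h]; simp)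
        rw [monomial_apply, if_neg this, mul_zero]
      · simp
    rcases eq_or_ne (η i (σ a)) 0 with h0 | h0
    · rw [he, h0, zero_mul, map_zero]; exact zero_le
    · rw [he, map_mul, valuation_zpow hϖ, valuation_eq_exp h0, ← WithZero.exp_add,
        WithZero.exp_le_exp, hc]
      have h3 := h2 h0 (hξ a)
      omega

end

/-! ### Monomial matrices that normalize a tiled order -/

section
variable {D : Type*} [DivisionRing D] {n : ℕ} {V : Valuation D ℤᵐ⁰} {μ : Matrix (Fin n) (Fin n) ℤ}
  {ϖ : Dˣ}
  {c : Fin n → ℤ} {σ : Equiv.Perm (Fin n)}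

lemma monomial_conj_apply (x : Matrix (Fin n) (Fin n) D) (i j : Fin n) :
    ((monomial ϖ c σ : Matrix (Fin n) (Fin n) D) * x *
      ((monomial ϖ c σ)⁻¹ : (Matrix (Fin n) (Fin n) D)ˣ)) i j =
      ((ϖ ^ c i : Dˣ) : D) * x (σ i) (σ j) * ((ϖ ^ (-c j) : Dˣ) : D) := by
  rw [Matrix.mul_apply, Finset.sum_eq_single (σ j), Matrix.mul_apply, Finset.sum_eq_single (σ i),
    monomial_apply, if_pos rfl, monomial_inv_apply, if_pos rfl]
  · intro b _ hb
    rw [monomial_apply, if_neg hb.symm, zero_mul]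
  · simp
  · intro b _ hb
    rw [monomial_inv_apply, if_neg hb.symm, mul_zero]
  · simp

lemma monomial_conj_mem_tiled_iff (hϖ : V ϖ = WithZero.exp (-1))
    (h : ∀ i j, μ i j = c i - c j + μ (σ i) (σ j)) (x : Matrix (Fin n) (Fin n) D) :
    (monomial ϖ c σ : Matrix (Fin n) (Fin n) D) * x *
      ((monomial ϖ c σ)⁻¹ : (Matrix (Fin n) (Fin n) D)ˣ) ∈ tiled V μ ↔ x ∈ tiled V μ := by
  have key : ∀ i j, V (((monomial ϖ c σ : Matrix (Fin n) (Fin n) D) * x *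
      ((monomial ϖ c σ)⁻¹ : (Matrix (Fin n) (Fin n) D)ˣ)) i j) ≤ WithZero.exp (-μ i j) ↔
      V (x (σ i) (σ j)) ≤ WithZero.exp (-μ (σ i) (σ j)) := by
    intro i j
    rw [monomial_conj_apply, map_mul, map_mul, valuation_zpow hϖ, valuation_zpow hϖ]
    rcases eq_or_ne (x (σ i) (σ j)) 0 with h0 | h0
    · simp [h0]
    · rw [valuation_eq_exp h0, ← WithZero.exp_add, ← WithZero.exp_add, WithZero.exp_le_exp,
        WithZero.exp_le_exp, h i j]
      omega
  refine ⟨fun hx i j => ?_, fun hx i j => (key i j).2 (hx _ _)⟩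
  have := (key (σ⁻¹ i) (σ⁻¹ j)).1 (hx _ _)
  simpa using this

lemma exponent_eq_of_monomial_normalizes (hϖ : V ϖ = WithZero.exp (-1))
    (h : ∀ x ∈ tiled V μ, (monomial ϖ c σ : Matrix (Fin n) (Fin n) D) * x *
      ((monomial ϖ c σ)⁻¹ : (Matrix (Fin n) (Fin n) D)ˣ) ∈ tiled V μ)
    (h' : ∀ x ∈ tiled V μ, (((monomial ϖ c σ)⁻¹ : (Matrix (Fin n) (Fin n) D)ˣ) :
        Matrix (Fin n) (Fin n) D) * x *
      monomial ϖ c σ ∈ tiled V μ) (i j : Fin n) : μ i j = c i - c j + μ (σ i) (σ j) := by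
  have hord : ∀ a : ℤ, ord V ((ϖ ^ a : Dˣ) : D) = a := fun a => by
    rw [ord, valuation_zpow hϖ]; simp
  have e1 : ∀ i, (monomial ϖ c σ : Matrix (Fin n) (Fin n) D) i (σ i) = ((ϖ ^ c i : Dˣ) : D) :=
    fun i => by rw [monomial_apply, if_pos rfl]
  have e2 : ∀ i, (((monomial ϖ c σ)⁻¹ : (Matrix (Fin n) (Fin n) D)ˣ) : Matrix (Fin n) (Fin n) D)
      (σ i) i = ((ϖ ^ (-c i) : Dˣ) : D) :=
    fun i => by rw [monomial_inv_apply, if_pos rfl]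
  have h1 := le_ord_add_of_conj_mem hϖ h (i := i) (a := σ i) (b := σ j) (j := j)
    (by rw [e1]; exact Units.ne_zero _) (by rw [e2]; exact Units.ne_zero _)
  have h2 := le_ord_add_of_conj_mem hϖ h' (i := σ i) (a := i) (b := j) (j := σ j)
    (by rw [e2]; exact Units.ne_zero _) (by rw [e1]; exact Units.ne_zero _)
  rw [e1, e2, hord, hord] at h1 h2
  omega

lemma mem_symmetryGroup_of_exponent_eq (h : ∀ i j, μ i j = c i - c j + μ (σ i) (σ j)) :
    σ ∈ symmetryGroup μ := by
  intro i j l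
  have h1 := h i j
  have h2 := h j l
  have h3 := h i l
  unfold structInv
  omega

lemma exponent_eq_of_mem_symmetryGroup [NeZero n] (h : σ ∈ symmetryGroup μ) (s : ℤ) (i j : Fin n) :
    μ i j = (μ i 0 - μ (σ i) (σ 0) + s) - (μ j 0 - μ (σ j) (σ 0) + s) + μ (σ i) (σ j) := by
  have h1 := h i j 0
  unfold structInv at h1
  omega

end

/-! ### Types and valuations of reduced norms -/

section
variable {k : Type*} [Field k] [CharZero k] [ValuativeRel k] [TopologicalSpace k]
  [IsNonarchimedeanLocalField k]
variable {D : Type*} [DivisionRing D] [Algebra k D] [FiniteDimensional k D] [Algebra.IsCentral k D]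
variable {n : ℕ} [NeZero n]

lemma mem_primePow_iff {Δ : Subalgebra 𝒪[k] D} (hΔ : Maximal (IsOrder k) Δ) {ϖ : Dˣ}
    (hϖ : valDiv k D ϖ = WithZero.exp (-1)) {x : D} {c : ℤ} :
    x ∈ primePow (Δ : Set D) ϖ c ↔ valDiv k D x ≤ WithZero.exp (-c) := by
  have hc : valDiv k D ((ϖ ^ c : Dˣ) : D) = WithZero.exp (-c) := valuation_zpow hϖ c
  constructor
  · rintro ⟨δ, hδ, rfl⟩
    rw [map_mul, hc]
    exact mul_le_of_le_one_right' ((mem_maximalOrder_iff hΔ).1 hδ)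
  · intro h
    refine ⟨((ϖ ^ (-c) : Dˣ) : D) * x, (mem_maximalOrder_iff hΔ).2 ?_, ?_⟩
    · rw [map_mul, valuation_zpow hϖ]
      refine (mul_le_mul_right h _).trans ?_
      rw [← WithZero.exp_add]
      simp
    · rw [← mul_assoc, ← Units.val_mul, ← zpow_add]
      simp

variable (k D n) in
/-- The valuation of the reduced norm of `M_n(D)`, as a homomorphism on `GL_n(D)`. -/
def valNr : (Matrix (Fin n) (Fin n) D)ˣ →* Multiplicative ℤ where
  toFun ξ := Multiplicative.ofAdd (val k (nr k (Matrix (Fin n) (Fin n) D) ξ))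
  map_one' := by simp [nr_one, val_one]
  map_mul' ξ η := by
    rw [Units.val_mul, nr_mul, val_mul (nr_ne_zero_of_isUnit ξ.isUnit)
      (nr_ne_zero_of_isUnit η.isUnit), ofAdd_add]

lemma toAdd_valNr (ξ : (Matrix (Fin n) (Fin n) D)ˣ) :
    (valNr k D n ξ).toAdd = val k (nr k (Matrix (Fin n) (Fin n) D) ξ) := rfl

lemma valNr_monomial {ϖ : Dˣ} (hϖ : valDiv k D ϖ = WithZero.exp (-1)) (c : Fin n → ℤ)
    (σ : Equiv.Perm (Fin n)) : (valNr k D n (monomial ϖ c σ)).toAdd = ∑ i, c i := by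
  -- permutation matrices have finite order, and `ℤ` has no torsion
  have h1 : (valNr k D n (monomial ϖ 0 σ)).toAdd = 0 := by
    have hpow : ∀ j : ℕ, monomial ϖ (0 : Fin n → ℤ) (σ ^ j) = monomial ϖ 0 σ ^ j := by
      intro j
      induction j with
      | zero => exact monomial_zero_one ϖ
      | succ j ih => rw [pow_succ', monomial_zero_mul, ih, pow_succ]
    have h := congrArg (fun x => (valNr k D n x).toAdd) (hpow (orderOf σ))
    simp only [pow_orderOf_eq_one, monomial_zero_one, map_one, map_pow, toAdd_one, toAdd_pow] at h
    have := (orderOf_pos σ).ne'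
    simpa [this] using h.symm
  have h0 : ∀ x : D, x ≠ 0 → nr k D x ≠ 0 := fun x hx => nr_ne_zero_of_isUnit (IsUnit.mk0 x hx)
  have h2 : (valNr k D n (diagHom D n fun i => ϖ ^ c i)).toAdd = ∑ i, c i := by
    have hprod : ∀ s : Finset (Fin n), val k (∏ i ∈ s, nr k D ((ϖ ^ c i : Dˣ) : D)) = ∑ i ∈ s,
        c i := by
      intro s
      induction s using Finset.induction_on with
      | empty => simp [val_one]
      | insert a s ha ih =>
        rw [Finset.prod_insert ha, Finset.sum_insert ha,
          val_mul (h0 _ (Units.ne_zero _)) (Finset.prod_ne_zero_iff.2 fun i _ =>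
              h0 _ (Units.ne_zero _)), ih]
        have h3 := valuation_zpow hϖ (c a)
        rw [valDiv_eq_exp (Units.ne_zero _), WithZero.exp_inj] at h3
        omega
    rw [toAdd_valNr, coe_diagHom, nr_diagonal, hprod]
  rw [monomial_eq, map_mul, toAdd_mul, h1, h2, add_zero]

/-- The type is the valuation of the reduced norm modulo `n`. A Dieudonné determinant is assumed to
exist so that `dieudonneDet g` is one. -/
lemma type_eq {g : (Matrix (Fin n) (Fin n) D)ˣ} (hg : ∃ c, IsDieudonneDet g c) :
    type k g = (((valNr k D n g).toAdd : ℤ) : ZMod n) := by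
  have hdet : IsDieudonneDet g (dieudonneDet g) := Classical.epsilon_spec hg
  obtain ⟨e, he, y, hy, hg⟩ := isDieudonneDet_iff.1 hdet
  have h0 := nr_ne_zero_of_isUnit (k := k) y.isUnit
  have h1 : nr k (Matrix (Fin n) (Fin n) D) g = nr k D y := by
    rw [hg, Units.val_mul, nr_mul, nr_elementary he, one_mul, coe_diagHom, nr_diagonal,
      Finset.prod_eq_single 0]
    · simp
    · intro i _ hi
      simp [Pi.mulSingle_eq_of_ne hi, nr_one]
    · simp
  rw [type, hy, toAdd_valNr, h1, valD, Abelianization.lift_apply_of]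
  congr 1
  change val k (Algebra.norm k (y : D)) / _ = _
  rw [← nr_pow_degree, val_pow h0, Int.mul_ediv_cancel_left]
  exact_mod_cast (degree_pos k).ne'

lemma type_xi (μ : Matrix (Fin n) (Fin n) ℤ) {ϖ : Dˣ} (hϖ : valDiv k D ϖ = WithZero.exp (-1)) (σ :
    Equiv.Perm (Fin n)) :
    type k (xi μ ϖ σ) = ((∑ i, (μ i 0 - μ (σ i) (σ 0)) : ℤ) : ZMod n) := by
  rw [← valNr_monomial hϖ _ σ]
  exact type_eq (exists_isDieudonneDet_monomial _ _ _)

end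

/-! ### Subgroups of `ℤ/nℤ` -/

section ZMod
variable {n : ℕ}

lemma intCast_mem_zmultiples_iff {d : ℕ} (hd : d ∣ n) (v : ℤ) :
    (v : ZMod n) ∈ AddSubgroup.zmultiples (d : ZMod n) ↔ (d : ℤ) ∣ v := by
  rw [AddSubgroup.mem_zmultiples_iff]
  constructor
  · rintro ⟨j, hj⟩
    have h : ((j * d : ℤ) : ZMod n) = (v : ZMod n) := by rw [← hj]; simp
    rw [ZMod.intCast_eq_intCast_iff_dvd_sub] at h
    have h2 : (d : ℤ) ∣ v - j * d := (Int.natCast_dvd_natCast.2 hd).trans h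
    exact (dvd_sub_left (dvd_mul_left _ _)).1 h2
  · rintro ⟨j, rfl⟩
    exact ⟨j, by push_cast; rw [zsmul_eq_mul, mul_comm]⟩

lemma existsUnique_zmultiples [NeZero n] (H : AddSubgroup (ZMod n)) :
    ∃! d : ℕ, d ∣ n ∧ (H : Set (ZMod n)) = AddSubgroup.zmultiples (d : ZMod n) := by
  obtain ⟨a, ha⟩ := Int.subgroup_cyclic (H.comap (Int.castAddHom (ZMod n)))
  rw [← AddSubgroup.zmultiples_eq_closure] at ha
  have hmem : ∀ v : ℤ, (v : ZMod n) ∈ H ↔ (a.natAbs : ℤ) ∣ v := by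
    intro v
    rw [Int.natAbs_dvd, ← Int.mem_zmultiples_iff, ← ha]
    rfl
  have hdvd : a.natAbs ∣ n := by
    have := (hmem n).1 (by simp)
    exact_mod_cast this
  refine ⟨a.natAbs, ⟨hdvd, ?_⟩, ?_⟩
  · ext x
    obtain ⟨v, rfl⟩ := ZMod.intCast_surjective x
    rw [SetLike.mem_coe, SetLike.mem_coe, hmem, intCast_mem_zmultiples_iff hdvd]
  · rintro d ⟨hd, hHd⟩
    have hmem' : ∀ v : ℤ, (v : ZMod n) ∈ H ↔ (d : ℤ) ∣ v := by
      intro v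
      rw [← SetLike.mem_coe, hHd, SetLike.mem_coe, intCast_mem_zmultiples_iff hd]
    have h1 := (hmem' a.natAbs).1 ((hmem _).2 dvd_rfl)
    have h2 := (hmem d).1 ((hmem' _).2 dvd_rfl)
    exact Nat.dvd_antisymm (by exact_mod_cast h1) (by exact_mod_cast h2)

end ZMod

/-! ### Normalizers -/

section
variable {A : Type*} [Ring A]

lemma mem_normalizer_iff {S : Set A} {ξ : Aˣ} : ξ ∈ normalizer S ↔
    (∀ x ∈ S, (ξ : A) * x * ((ξ⁻¹ : Aˣ) : A) ∈ S) ∧ ∀ x ∈ S, ((ξ⁻¹ : Aˣ) : A) * x * ξ ∈ S := by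
  constructor
  · intro h
    have h : (fun x : A => (ξ : A) * x * ((ξ⁻¹ : Aˣ) : A)) '' S = S := h
    refine ⟨fun x hx => h ▸ Set.mem_image_of_mem _ hx, fun x hx => ?_⟩
    rw [← h] at hx
    obtain ⟨y, hy, rfl⟩ := hx
    simpa [mul_assoc] using hy
  · rintro ⟨h1, h2⟩
    refine Set.Subset.antisymm (Set.image_subset_iff.2 h1) fun x hx => ⟨_, h2 x hx, ?_⟩
    simp [mul_assoc]

/-- The normalizer of a subset of a ring, as a subgroup of the group of units. -/
def normalizerSubgroup (S : Set A) : Subgroup Aˣ where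
  carrier := normalizer S
  one_mem' := mem_normalizer_iff.2 (by simp)
  mul_mem' := by
    intro ξ η hξ hη
    rw [mem_normalizer_iff] at *
    refine ⟨fun x hx => ?_, fun x hx => ?_⟩
    · simpa [mul_assoc] using hξ.1 _ (hη.1 x hx)
    · simpa [mul_assoc] using hη.2 _ (hξ.2 x hx)
  inv_mem' := by
    intro ξ hξ
    rw [mem_normalizer_iff] at *
    exact ⟨by simpa using hξ.2, by simpa using hξ.1⟩

lemma conj_mem_normalizer_iff {S T : Set A} {g : Aˣ}
    (h : ∀ x, x ∈ S ↔ ((g⁻¹ : Aˣ) : A) * x * g ∈ T) {ξ : Aˣ} :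
    g * ξ * g⁻¹ ∈ normalizer S ↔ ξ ∈ normalizer T := by
  have hT : ∀ y, y ∈ T ↔ (g : A) * y * ((g⁻¹ : Aˣ) : A) ∈ S := fun y => by
    rw [h]; simp [mul_assoc]
  simp only [mem_normalizer_iff, h, mul_inv_rev, inv_inv, Units.val_mul]
  constructor
  · rintro ⟨h1, h2⟩
    refine ⟨fun y hy => ?_, fun y hy => ?_⟩
    · simpa [mul_assoc] using h1 (g * y * ((g⁻¹ : Aˣ) : A)) (by simpa [mul_assoc] using hy)
    · simpa [mul_assoc] using h2 (g * y * ((g⁻¹ : Aˣ) : A)) (by simpa [mul_assoc] using hy)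
  · rintro ⟨h1, h2⟩
    refine ⟨fun x hx => ?_, fun x hx => ?_⟩
    · simpa [mul_assoc] using h1 _ hx
    · simpa [mul_assoc] using h2 _ hx

end

/-! ### The exponent matrix -/

section
variable {D : Type*} [DivisionRing D] {n : ℕ} {V : Valuation D ℤᵐ⁰}

/-- A bounded subring of `M_n(D)` that contains the diagonal matrices over the valuation ring, and
in which every entry takes a nonzero value, is of the form `(𝔭 ^ μ_{ij})`. -/
lemma exists_exponentMatrix_of_bounded {S : Subring (Matrix (Fin n) (Fin n) D)}
    (hdiag : ∀ a : Fin n → D, (∀ i, V (a i) ≤ 1) → Matrix.diagonal a ∈ S)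
    {B : ℤ} (hB : ∀ x ∈ S, ∀ i j, V (x i j) ≤ WithZero.exp B)
    (hne : ∀ i j, ∃ x ∈ S, x i j ≠ 0) :
    ∃ μ : Matrix (Fin n) (Fin n) ℤ, IsExponentMatrix μ ∧ ∀ x, x ∈ S ↔ x ∈ tiled V μ := by
  have hsingle : ∀ i (c : D), V c ≤ 1 → Matrix.single i i c ∈ S := by
    intro i c hc
    rw [← Matrix.diagonal_single]
    refine hdiag _ fun j => ?_
    by_cases h : j = i
    · subst h; simpa using hc
    · simp [h]
  have hcomp : ∀ x ∈ S, ∀ i j, Matrix.single i j (x i j) ∈ S := by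
    intro x hx i j
    have := S.mul_mem (S.mul_mem (hsingle i 1 (by simp)) hx) (hsingle j 1 (by simp))
    rwa [Matrix.single_mul_mul_single, one_mul, mul_one] at this
  have hmin : ∀ i j, ∃ c : D, c ≠ 0 ∧ Matrix.single i j c ∈ S ∧
      ∀ c', c' ≠ 0 → Matrix.single i j c' ∈ S → ord V c ≤ ord V c' := by
    intro i j
    obtain ⟨l, ⟨c, hc0, hc, rfl⟩, hl⟩ := Int.exists_least_of_bdd
      (P := fun l => ∃ c : D, c ≠ 0 ∧ Matrix.single i j c ∈ S ∧ ord V c = l)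
      ⟨-B, by
        rintro _ ⟨c, hc0, hc, rfl⟩
        have := hB _ hc i j
        rw [Matrix.single_apply_same, valuation_eq_exp hc0, WithZero.exp_le_exp] at this
        omega⟩ (by
        obtain ⟨x, hx, hx0⟩ := hne i j
        exact ⟨_, _, hx0, hcomp x hx i j, rfl⟩)
    exact ⟨c, hc0, hc, fun c' h0 h1 => hl _ ⟨c', h0, h1, rfl⟩⟩
  choose c hc0 hc hcmin using hmin
  set μ : Matrix (Fin n) (Fin n) ℤ := fun i j => ord V (c i j) with hμ
  have hVc : ∀ i j, V (c i j) = WithZero.exp (-μ i j) := fun i j => valuation_eq_exp (hc0 i j)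
  have hmem : ∀ i j x, Matrix.single i j x ∈ S ↔ V x ≤ WithZero.exp (-μ i j) := by
    intro i j x
    rcases eq_or_ne x 0 with rfl | hx
    · simp [S.zero_mem]
    constructor
    · intro h
      rw [valuation_eq_exp hx, WithZero.exp_le_exp]
      exact neg_le_neg (hcmin i j x hx h)
    · intro h
      have := S.mul_mem (hc i j) (hsingle j ((c i j)⁻¹ * x) (by
        rw [map_mul, map_inv₀, hVc, ← div_eq_inv_mul]
        exact div_le_one_of_le₀ h zero_le))
      rwa [Matrix.single_mul_single_same, mul_inv_cancel_left₀ (hc0 i j)] at this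
  have htri : ∀ i j l, μ i l ≤ μ i j + μ j l := by
    intro i j l
    have := S.mul_mem (hc i j) (hc j l)
    rw [Matrix.single_mul_single_same, hmem, map_mul, hVc, hVc, ← WithZero.exp_add,
      WithZero.exp_le_exp] at this
    omega
  refine ⟨μ, ⟨fun i => ?_, htri⟩, fun x => ⟨fun hx i j => (hmem i j _).1 (hcomp x hx i j), fun hx =>
    ?_⟩⟩
  · have h1 := htri i i i
    have h2 := (hmem i i 1).1 (hsingle i 1 (by simp))
    rw [map_one, ← WithZero.exp_zero, WithZero.exp_le_exp] at h2
    omega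
  · rw [Matrix.matrix_eq_sum_single x]
    exact S.sum_mem fun i _ => S.sum_mem fun j _ => (hmem i j _).2 (hx i j)

lemma mul_mem_tiled {μ : Matrix (Fin n) (Fin n) ℤ} (hμ : IsExponentMatrix μ) {x y :
    Matrix (Fin n) (Fin n) D}
    (hx : x ∈ tiled V μ) (hy : y ∈ tiled V μ) : x * y ∈ tiled V μ := by
  intro i l
  rw [Matrix.mul_apply]
  refine V.map_sum_le fun j _ => ?_
  rw [map_mul]
  refine (mul_le_mul' (hx i j) (hy j l)).trans ?_
  rw [← WithZero.exp_add, WithZero.exp_le_exp]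
  have := hμ.triangle i j l
  omega

/-- Diagonal matrices with entries of valuation one normalize `(𝔭 ^ μ_{ij})`. -/
lemma diagHom_mem_normalizer (μ : Matrix (Fin n) (Fin n) ℤ) {b : Fin n → Dˣ} (hb :
    ∀ i, V (b i) = 1) :
    diagHom D n b ∈ normalizer (tiled V μ) := by
  have key : ∀ b : Fin n → Dˣ, (∀ i, V (b i) = 1) → ∀ x ∈ tiled V μ,
      (diagHom D n b : Matrix (Fin n) (Fin n) D) * x * (diagHom D n b⁻¹ :
          (Matrix (Fin n) (Fin n) D)ˣ) ∈ tiled V μ := by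
    intro b hb x hx i j
    rw [coe_diagHom, coe_diagHom, Matrix.mul_diagonal, Matrix.diagonal_mul, map_mul, map_mul, hb,
      Pi.inv_apply, Units.val_inv_eq_inv_val, map_inv₀, hb, one_mul, inv_one, mul_one]
    exact hx i j
  rw [mem_normalizer_iff, ← map_inv]
  refine ⟨key b hb, ?_⟩
  simpa only [inv_inv] using key b⁻¹ fun i => by
    rw [Pi.inv_apply, Units.val_inv_eq_inv_val, map_inv₀, hb, inv_one]

end

section
variable {k : Type*} [Field k] [CharZero k]
variable {D : Type*} [DivisionRing D] [Algebra k D] [FiniteDimensional k D] [Algebra.IsCentral k D]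
variable {n : ℕ}

lemma nr_conj (g ξ : (Matrix (Fin n) (Fin n) D)ˣ) [NeZero n] :
    nr k (Matrix (Fin n) (Fin n) D) (g * ξ * g⁻¹ :
        (Matrix (Fin n) (Fin n) D)ˣ) = nr k (Matrix (Fin n) (Fin n) D) ξ := by
  have h : nr k (Matrix (Fin n) (Fin n) D) g * nr k (Matrix (Fin n) (Fin n) D) (g⁻¹ :
      (Matrix (Fin n) (Fin n) D)ˣ) = 1 := by
    rw [← nr_mul, Units.mul_inv, nr_one]
  rw [Units.val_mul, Units.val_mul, nr_mul, nr_mul, mul_right_comm, h, one_mul]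

end

section
variable {k : Type*} [Field k] [CharZero k] [ValuativeRel k] [TopologicalSpace k]
  [IsNonarchimedeanLocalField k]
variable {D : Type*} [DivisionRing D] [Algebra k D] [FiniteDimensional k D] [Algebra.IsCentral k D]
variable {n : ℕ}

/-- A tiled order is conjugate to some `(𝔭 ^ μ_{ij})`. It is bounded as it is finitely generated,
and its entries do not vanish identically as it spans `M_n(D)`. -/
lemma exists_exponentMatrix {Δ : Subalgebra 𝒪[k] D} (hΔ : Maximal (IsOrder k) Δ)
    {Γ : Subalgebra 𝒪[k] (Matrix (Fin n) (Fin n) D)} (hΓ : IsOrder k Γ)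
    (g : (Matrix (Fin n) (Fin n) D)ˣ)
    (hg : ∀ a : Fin n → D, (∀ i, a i ∈ Δ) →
      (g : Matrix (Fin n) (Fin n) D) * Matrix.diagonal a *
        ((g⁻¹ : (Matrix (Fin n) (Fin n) D)ˣ) : Matrix (Fin n) (Fin n) D) ∈ Γ) :
    ∃ μ : Matrix (Fin n) (Fin n) ℤ, IsExponentMatrix μ ∧
        ∀ x, x ∈ (Γ : Set (Matrix (Fin n) (Fin n) D)) ↔
      ((g⁻¹ : (Matrix (Fin n) (Fin n) D)ˣ) : Matrix (Fin n) (Fin n) D) * x * g ∈ tiled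
          (valDiv k D) μ := by
  let S : Subring (Matrix (Fin n) (Fin n) D) := Γ.toSubring.comap
    (MulSemiringAction.toRingHom (ConjAct (Matrix (Fin n) (Fin n) D)ˣ) _ (ConjAct.toConjAct g))
  have hS : ∀ y, y ∈ S ↔ (g : Matrix (Fin n) (Fin n) D) * y *
      ((g⁻¹ : (Matrix (Fin n) (Fin n) D)ˣ) : Matrix (Fin n) (Fin n) D) ∈ Γ := fun y => Iff.rfl
  have hΓS : ∀ x, x ∈ Γ ↔ ((g⁻¹ : (Matrix (Fin n) (Fin n) D)ˣ) : Matrix (Fin n) (Fin n) D) * x * g ∈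
      S := by
    intro x
    rw [hS]
    simp [mul_assoc]
  obtain ⟨B, hB⟩ : ∃ B :
    ℤ, ∀ x ∈ Γ, ∀ i j, valDiv k D
        ((((g⁻¹ : (Matrix (Fin n) (Fin n) D)ˣ) : Matrix (Fin n) (Fin n) D) * x * g) i j) ≤
            WithZero.exp B := by
    obtain ⟨s, hs⟩ := hΓ.fg
    obtain ⟨B, hB⟩ := (Set.finite_range fun p : s × Fin n × Fin n =>
      WithZero.log (valDiv k D
          ((((g⁻¹ : (Matrix (Fin n) (Fin n) D)ˣ) : Matrix (Fin n) (Fin n) D) * p.1 * g) p.2.1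
              p.2.2))).bddAbove
    refine ⟨B, fun x hx => ?_⟩
    replace hx : x ∈ Submodule.span 𝒪[k] (s : Set (Matrix (Fin n) (Fin n) D)) := hs ▸ hx
    induction hx using Submodule.span_induction with
    | mem x hx =>
      intro i j
      have h1 := hB ⟨(⟨x, hx⟩, i, j), rfl⟩
      exact WithZero.le_exp_log.trans (WithZero.exp_le_exp.2 h1)
    | zero => simp
    | add x y _ _ hx hy =>
      intro i j
      rw [mul_add, add_mul, Matrix.add_apply]
      exact ((valDiv k D).map_add _ _).trans (max_le (hx i j) (hy i j))
    | smul r x _ hx =>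
      intro i j
      rw [Matrix.mul_smul, Matrix.smul_mul, Matrix.smul_apply, Algebra.smul_def, map_mul]
      exact (mul_le_of_le_one_left' (valDiv_algebraMap_le_one r)).trans (hx i j)
  obtain ⟨μ, hμ, h⟩ := exists_exponentMatrix_of_bounded (V := valDiv k D) (S := S) (B := B)
    (fun a ha => (hS _).2 (hg a fun i => (mem_maximalOrder_iff hΔ).2 (ha i)))
    (fun x hx i j => by simpa [mul_assoc] using hB _ ((hS x).1 hx) i j) (by
      -- otherwise the entry would vanish on the whole `k`-span of the order
      intro i j
      by_contra! h0
      let f : Matrix (Fin n) (Fin n) D →ₗ[k] D :=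
        { toFun := fun x => (((g⁻¹ : (Matrix (Fin n) (Fin n) D)ˣ) :
            Matrix (Fin n) (Fin n) D) * x * g) i j
          map_add' := fun x y => by simp [mul_add, add_mul]
          map_smul' := fun r x => by simp }
      have hf : ∀ x, f x = 0 := by
        intro x
        have hx : x ∈ Submodule.span k (Γ : Set (Matrix (Fin n) (Fin n) D)) := by
          rw [hΓ.span_eq_top]; trivial
        have hle : Submodule.span k (Γ : Set (Matrix (Fin n) (Fin n) D)) ≤ LinearMap.ker f :=
          Submodule.span_le.2 fun y hy => h0 _ ((hΓS y).1 hy)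
        exact hle hx
      have h1 := hf ((g : Matrix (Fin n) (Fin n) D) * Matrix.single i j 1 *
        ((g⁻¹ : (Matrix (Fin n) (Fin n) D)ˣ) : Matrix (Fin n) (Fin n) D))
      simp [f, mul_assoc] at h1)
  exact ⟨μ, hμ, fun x => (hΓS x).trans (h _)⟩

variable [NeZero n]

/-! ### The reduced norms of the normalizer -/

/-- The reduced norm of a unit of an order has valuation zero. -/
lemma valNr_eq_zero_of_mem {Γ : Subalgebra 𝒪[k] (Matrix (Fin n) (Fin n) D)} (hΓ : IsOrder k Γ)
    {u : (Matrix (Fin n) (Fin n) D)ˣ} (hu : (u : Matrix (Fin n) (Fin n) D) ∈ Γ)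
    (hu' : ((u⁻¹ : (Matrix (Fin n) (Fin n) D)ˣ) : Matrix (Fin n) (Fin n) D) ∈ Γ) :
    (valNr k D n u).toAdd = 0 := by
  have key : ∀ u : (Matrix (Fin n) (Fin n) D)ˣ, (u : Matrix (Fin n) (Fin n) D) ∈ Γ →
      0 ≤ (valNr k D n u).toAdd := by
    intro u hu
    obtain ⟨y, hy⟩ := IsIntegrallyClosed.isIntegral_iff.1 (isIntegral_nr (k :=
      k) (IsIntegral.of_mem_of_fg Γ hΓ.fg _ hu))
    rw [toAdd_valNr, ← mem_integer_iff_val_nonneg (nr_ne_zero_of_isUnit u.isUnit), ← hy]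
    exact y.2
  have h1 := key u hu
  have h2 := key u⁻¹ hu'
  rw [map_inv, toAdd_inv] at h2
  omega

variable {μ : Matrix (Fin n) (Fin n) ℤ} {ϖ : Dˣ}

/-- The integers lying over the set of types are the valuations of the reduced norms of the elements
of the normalizer of `(𝔭 ^ μ_{ij})`. -/
lemma intCast_mem_typeSet_iff (hμ : IsExponentMatrix μ) (hϖ : valDiv k D ϖ = WithZero.exp (-1))
    (hu : ∀ u : (Matrix (Fin n) (Fin n) D)ˣ, (u : Matrix (Fin n) (Fin n) D) ∈ tiled (valDiv k D) μ →
      ((u⁻¹ : (Matrix (Fin n) (Fin n) D)ˣ) : Matrix (Fin n) (Fin n) D) ∈ tiled (valDiv k D) μ →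
      (valNr k D n u).toAdd = 0) (v : ℤ) :
    (v : ZMod n) ∈ typeSet μ k ϖ ↔ ∃ ξ ∈ normalizer (tiled (valDiv k D) μ),
        (valNr k D n ξ).toAdd = v := by
  constructor
  · rintro ⟨σ, hσ, h⟩
    rw [type_xi μ hϖ, ← sub_eq_zero, ← Int.cast_sub, ZMod.intCast_zmod_eq_zero_iff_dvd] at h
    obtain ⟨s, hs⟩ := h
    -- `ξ_σ` times the scalar `ϖ ^ s`
    have hexp := exponent_eq_of_mem_symmetryGroup hσ s
    refine ⟨monomial ϖ (fun i => μ i 0 - μ (σ i) (σ 0) + s) σ, mem_normalizer_iff.2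
      ⟨fun x hx => (monomial_conj_mem_tiled_iff hϖ hexp x).2 hx, fun x hx =>
        (monomial_conj_mem_tiled_iff hϖ hexp _).1 (by simpa [mul_assoc] using hx)⟩, ?_⟩
    rw [valNr_monomial hϖ, Finset.sum_add_distrib]
    simp only [Finset.sum_const, Finset.card_univ, Fintype.card_fin, nsmul_eq_mul]
    linarith
  · rintro ⟨ξ, hξ, rfl⟩
    obtain ⟨h1, h2⟩ := mem_normalizer_iff.1 hξ
    obtain ⟨c, σ, u, rfl, hu1, hu2⟩ := exists_monomial_mul_of_normalizes hϖ hμ h1 h2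
    have hu_norm : u ∈ normalizer (tiled (valDiv k D) μ) := mem_normalizer_iff.2
      ⟨fun x hx => mul_mem_tiled hμ (mul_mem_tiled hμ hu1 hx) hu2,
        fun x hx => mul_mem_tiled hμ (mul_mem_tiled hμ hu2 hx) hu1⟩
    have hmon : monomial ϖ c σ ∈ normalizerSubgroup (tiled (valDiv k D) μ) := by
      simpa using (normalizerSubgroup (tiled (valDiv k D) μ)).mul_mem hξ
        ((normalizerSubgroup (tiled (valDiv k D) μ)).inv_mem hu_norm)
    obtain ⟨h3, h4⟩ := mem_normalizer_iff.1 hmon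
    have hexp := exponent_eq_of_monomial_normalizes hϖ h3 h4
    refine ⟨σ, mem_symmetryGroup_of_exponent_eq hexp, ?_⟩
    rw [type_xi μ hϖ, map_mul, toAdd_mul, hu u hu1 hu2, add_zero, valNr_monomial hϖ]
    have h5 : ∀ i, μ i 0 - μ (σ i) (σ 0) = c i - c 0 := fun i => by rw [hexp i 0]; ring
    simp [h5, Finset.sum_sub_distrib]

lemma existsUnique_typeSet (hμ : IsExponentMatrix μ) (hϖ : valDiv k D ϖ = WithZero.exp (-1))
    (hu : ∀ u : (Matrix (Fin n) (Fin n) D)ˣ, (u : Matrix (Fin n) (Fin n) D) ∈ tiled (valDiv k D) μ →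
      ((u⁻¹ : (Matrix (Fin n) (Fin n) D)ˣ) : Matrix (Fin n) (Fin n) D) ∈ tiled (valDiv k D) μ →
      (valNr k D n u).toAdd = 0) :
    ∃! d : ℕ, d ∣ n ∧ typeSet μ k ϖ = (AddSubgroup.zmultiples (d : ZMod n) : Set (ZMod n)) := by
  let H : AddSubgroup (ZMod n) := ((normalizerSubgroup (tiled (valDiv k D) μ)).map
    ((AddMonoidHom.toMultiplicative (Int.castAddHom (ZMod n))).comp (valNr k D n))).toAddSubgroup'
  have hH : typeSet μ k ϖ = H := by
    ext t
    obtain ⟨v, rfl⟩ := ZMod.intCast_surjective t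
    constructor
    · intro h
      obtain ⟨ξ, hξ, rfl⟩ := (intCast_mem_typeSet_iff hμ hϖ hu v).1 h
      exact ⟨ξ, hξ, rfl⟩
    · rintro ⟨ξ, hξ, h⟩
      rw [← show (((valNr k D n ξ).toAdd : ℤ) : ZMod n) = v from h]
      exact (intCast_mem_typeSet_iff hμ hϖ hu _).2 ⟨ξ, hξ, rfl⟩
  rw [hH]
  exact existsUnique_zmultiples H

lemma nr_image_normalizer_tiled (hμ : IsExponentMatrix μ) {Δ : Subalgebra 𝒪[k] D}
    (hΔ : Maximal (IsOrder k) Δ) {π : 𝒪[k]} (hπ : Irreducible π)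
    (hϖ : (ϖ : D) ^ degree k D = algebraMap k D (π : k))
    (hu : ∀ u : (Matrix (Fin n) (Fin n) D)ˣ, (u : Matrix (Fin n) (Fin n) D) ∈ tiled (valDiv k D) μ →
      ((u⁻¹ : (Matrix (Fin n) (Fin n) D)ˣ) : Matrix (Fin n) (Fin n) D) ∈ tiled (valDiv k D) μ →
      (valNr k D n u).toAdd = 0) {d : ℕ} (hd : d ∣ n)
    (ht : typeSet μ k ϖ = (AddSubgroup.zmultiples (d : ZMod n) : Set (ZMod n))) :
    (fun ξ : (Matrix (Fin n) (Fin n) D)ˣ => nr k (Matrix (Fin n) (Fin n) D) (ξ :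
        Matrix (Fin n) (Fin n) D)) ''
      normalizer (tiled (valDiv k D) μ) = powUnits k d := by
  have key : ∀ v : ℤ, (d : ℤ) ∣ v ↔ ∃ ξ ∈ normalizer (tiled (valDiv k D) μ),
      (valNr k D n ξ).toAdd = v := by
    intro v
    rw [← intCast_mem_typeSet_iff hμ (valDiv_uniformizer hπ hϖ) hu, ht, SetLike.mem_coe,
      intCast_mem_zmultiples_iff hd]
  have hπ0 : (π : k) ≠ 0 := fun h => hπ.ne_zero (Subtype.ext h)
  ext x
  constructor
  · rintro ⟨ξ, hξ, rfl⟩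
    have h0 := nr_ne_zero_of_isUnit (k := k) ξ.isUnit
    obtain ⟨s, hs⟩ := (key _).2 ⟨ξ, hξ, rfl⟩
    rw [toAdd_valNr] at hs
    have h1 : ((π : k) ^ s) ^ d ≠ 0 := pow_ne_zero _ (zpow_ne_zero _ hπ0)
    obtain ⟨u, hu⟩ := exists_unit_of_val_eq_zero (mul_ne_zero h0 (inv_ne_zero h1)) (by
      rw [val_mul h0 (inv_ne_zero h1), val_inv h1, val_pow (zpow_ne_zero _ hπ0), val_zpow hπ0,
        val_irreducible hπ, hs]
      ring)
    refine ⟨Units.mk0 _ (zpow_ne_zero s hπ0), u, ?_⟩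
    rw [hu, Units.val_mk0, mul_comm, inv_mul_cancel_right₀ h1]
  · rintro ⟨a, u, rfl⟩
    obtain ⟨ξ, hξ, hv⟩ := (key (d * val k (a : k))).1 (dvd_mul_right _ _)
    rw [toAdd_valNr] at hv
    have h0 := nr_ne_zero_of_isUnit (k := k) ξ.isUnit
    have ha : (a : k) ^ d ≠ 0 := pow_ne_zero _ a.ne_zero
    have hu0 : ((u : 𝒪[k]) : k) ≠ 0 := fun h => u.ne_zero (Subtype.ext h)
    -- correct the reduced norm by a unit, which is the reduced norm of a diagonal matrix
    obtain ⟨w, hw⟩ := exists_unit_of_val_eq_zero (mul_ne_zero (mul_ne_zero ha hu0) (inv_ne_zero h0))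
      (by
      rw [val_mul (mul_ne_zero ha hu0) (inv_ne_zero h0), val_mul ha hu0, val_inv h0,
        val_pow a.ne_zero, val_unit, hv]
      ring)
    obtain ⟨θ, hθ⟩ := exists_nr_eq_unit hΔ hπ hϖ w
    have hθ0 : θ ≠ 0 := by
      rintro rfl
      rw [nr_zero] at hθ
      exact w.ne_zero (Subtype.ext hθ.symm)
    have hVθ : valDiv k D θ = 1 := by
      rw [valDiv_eq_exp hθ0, hθ, val_unit, neg_zero, WithZero.exp_zero]
    refine ⟨diagHom D n (Pi.mulSingle 0 (Units.mk0 θ hθ0)) * ξ,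
      (normalizerSubgroup (tiled (valDiv k D) μ)).mul_mem (diagHom_mem_normalizer μ fun i => ?_) hξ,
          ?_⟩
    · by_cases hi : i = 0
      · subst hi; simpa using hVθ
      · simp [hi]
    · have h1 : nr k (Matrix (Fin n) (Fin n) D) (diagHom D n (Pi.mulSingle 0 (Units.mk0 θ hθ0))) =
        nr k D θ := by
        rw [coe_diagHom, nr_diagonal, Finset.prod_eq_single 0]
        · simp
        · intro i _ hi
          simp [Pi.mulSingle_eq_of_ne hi, nr_one]
        · simp
      change nr k _ _ = _
      rw [Units.val_mul, nr_mul, h1, hθ, hw, inv_mul_cancel_right₀ h0]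

end

end

end TiledOrder

theorem mainTheorem3
    (k : Type*) [Field k] [CharZero k] [ValuativeRel k] [TopologicalSpace k]
    [IsNonarchimedeanLocalField k]
    (D : Type*) [DivisionRing D] [Algebra k D] [FiniteDimensional k D] [Algebra.IsCentral k D]
    (Δ : Subalgebra 𝒪[k] D) (hΔ : Maximal (TiledOrder.IsOrder k) Δ)
    (ϖ : Dˣ) (π : 𝒪[k]) (hπ : Irreducible π)
    (hϖ : (ϖ : D) ^ TiledOrder.degree k D = algebraMap k D (π : k))
    (n : ℕ) [NeZero n]
    (Γ : Subalgebra 𝒪[k] (Matrix (Fin n) (Fin n) D)) (hΓ : TiledOrder.IsOrder k Γ)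
    (g : (Matrix (Fin n) (Fin n) D)ˣ)
    (hg : ∀ a : Fin n → D, (∀ i, a i ∈ Δ) →
      (g : Matrix (Fin n) (Fin n) D) * Matrix.diagonal a *
        ((g⁻¹ : (Matrix (Fin n) (Fin n) D)ˣ) : Matrix (Fin n) (Fin n) D) ∈ Γ) :
    ∃ μ : Matrix (Fin n) (Fin n) ℤ,
      (∀ x : Matrix (Fin n) (Fin n) D, x ∈ Γ ↔
        ∀ i j, (((g⁻¹ : (Matrix (Fin n) (Fin n) D)ˣ) : Matrix (Fin n) (Fin n) D) * x *
          (g : Matrix (Fin n) (Fin n) D)) i j ∈ TiledOrder.primePow (Δ : Set D) ϖ (μ i j)) ∧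
      (∃! d : ℕ, d ∣ n ∧
        TiledOrder.typeSet μ k ϖ = (AddSubgroup.zmultiples (d : ZMod n) : Set (ZMod n))) ∧
      ∀ d : ℕ, d ∣ n →
        TiledOrder.typeSet μ k ϖ = (AddSubgroup.zmultiples (d : ZMod n) : Set (ZMod n)) →
        (fun ξ : (Matrix (Fin n) (Fin n) D)ˣ =>
            TiledOrder.nr k (Matrix (Fin n) (Fin n) D) (ξ : Matrix (Fin n) (Fin n) D)) ''
          TiledOrder.normalizer (Γ : Set (Matrix (Fin n) (Fin n) D)) =
        TiledOrder.powUnits k d := by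
  have hV := TiledOrder.valDiv_uniformizer hπ hϖ
  obtain ⟨μ, hμ, hΓμ⟩ := TiledOrder.exists_exponentMatrix hΔ hΓ g hg
  have hunit : ∀ u : (Matrix (Fin n) (Fin n) D)ˣ,
      (u : Matrix (Fin n) (Fin n) D) ∈ TiledOrder.tiled (TiledOrder.valDiv k D) μ →
      ((u⁻¹ : (Matrix (Fin n) (Fin n) D)ˣ) : Matrix (Fin n) (Fin n) D) ∈
        TiledOrder.tiled (TiledOrder.valDiv k D) μ →
      (TiledOrder.valNr k D n u).toAdd = 0 := by
    intro u hu hu'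
    have hmem : ∀ v : (Matrix (Fin n) (Fin n) D)ˣ,
        (v : Matrix (Fin n) (Fin n) D) ∈ TiledOrder.tiled (TiledOrder.valDiv k D) μ →
        ((g * v * g⁻¹ : (Matrix (Fin n) (Fin n) D)ˣ) : Matrix (Fin n) (Fin n) D) ∈ Γ :=
      fun v hv => (hΓμ _).2 (by simpa [mul_assoc] using hv)
    have h := TiledOrder.valNr_eq_zero_of_mem hΓ (hmem u hu)
      (by simpa [mul_assoc] using hmem u⁻¹ hu')
    rwa [TiledOrder.toAdd_valNr, TiledOrder.nr_conj] at h
  refine ⟨μ, fun x => ?_, TiledOrder.existsUnique_typeSet hμ hV hunit, fun d hd ht => ?_⟩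
  · refine (hΓμ x).trans (forall_congr' fun i => forall_congr' fun j => ?_)
    exact (TiledOrder.mem_primePow_iff hΔ hV).symm
  · rw [← TiledOrder.nr_image_normalizer_tiled hμ hΔ hπ hϖ hunit hd ht]
    ext x
    constructor
    · rintro ⟨ξ, hξ, rfl⟩
      have hξ' : g * (g⁻¹ * ξ * g) * g⁻¹ = ξ := by group
      refine ⟨g⁻¹ * ξ * g, (TiledOrder.conj_mem_normalizer_iff hΓμ).1 (by rwa [hξ']), ?_⟩
      change TiledOrder.nr k _ _ = TiledOrder.nr k _ _
      rw [← TiledOrder.nr_conj g, hξ']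
    · rintro ⟨ξ, hξ, rfl⟩
      exact ⟨g * ξ * g⁻¹, (TiledOrder.conj_mem_normalizer_iff hΓμ).2 hξ, TiledOrder.nr_conj g ξ⟩
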